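/- Let $\mathbb{A}$ be the field of real algebraic numbers and let $\mathcal{S}$ be a ring with $\mathbb{Z}\le\mathcal{S}\le\mathbb{A}$. A \emph{loop} $(\varphi,\vec a)$ in the variables $\vec x=(x_1,\dots,x_d)$ consists of an update $\vec a=(a_1,\dots,a_d)\in(\mathbb{A}[\vec x])^d$ and a condition $\varphi$, which is an arbitrary propositional formula over atoms $p\ge 0$ and $p>0$ with $p\in\mathbb{A}[\vec x]$. It \emph{terminates} on $F\subseteq\mathbb{A}^d$ if there is no $\vec c\in F$ such that $\varphi(\vec a^{\,n}(\vec c))$ holds for all $n\in\mathbb{N}$; the set $F$ is \emph{$\vec a$-invariant} if $\vec a(\vec c)\in F$ for all $\vec c\in F$. The loop is \emph{triangular} if the transitive closure $\succ$ of $\{(x_i,x_j)\mid i\ne j,\ x_j\text{ occurs in }a_i\}$ is well founded. It is \emph{weakly non-linear} if no $x_i$ occurs in a monomial of $a_i$ of degree at least $2$, and \emph{non-negative} if, moreover, the coefficient of $x_i$ in $a_i$ is non-negative for all $i$. A \emph{twn-loop} is a triangular weakly non-linear loop; a \emph{tnn-loop} is a triangular non-negative loop. $\mathrm{Th}_\exists(\mathcal{S},\mathbb{A})$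 is the set of formulas $\exists \vec y\,'\in\mathbb{A}^{k'},\ \vec y\in\mathcal{S}^{k}.\ \psi$ with $k',k\in\mathbb{N}$ and $\psi$ a propositional formula over atoms $p\ge0$ and $p>0$, where $p$ is a polynomial with rational coefficients in $\vec y\,',\vec y$ and the free variables; if algebraic coefficients are allowed, we say that the formula has real algebraic coefficients. A set $F\subseteq\mathbb{A}^d$ is \emph{defined} by such a formula $\psi_F$ with free variables $\vec x$ if, for all $\vec c\in\mathbb{A}^d$, $\vec c\in F$ iff $\psi_F(\vec c)$ is true. In inputs of algorithms a real algebraic number is given by an integer polynomial and an open interval with rational endpoints in which that number is the only real root of the polynomial. \textbf{Theorem (Reducing Termination).} Termination of tnn-loops on update-invariant sets that are definable in $\mathrm{Th}_\exists(\mathcal{S},\mathbb{A})$ is reducible to validity in $\mathrm{Th}_\exists(\mathcal{S},\mathbb{A})$, and so is termination of twn-loops on such sets. That is, for each of the two classes there is a computable function which, given a loop $(\varphi,\vec a)$ of the class, in any number $d$ of variables, and a formula $\psi_F$ of $\mathrm{Th}_\exists(\mathcal{S},\mathbb{A})$ with real algebraic coefficients that defines an $\vec a$-invariant set $F\subseteq\mathbb{A}^d$,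 returns a closed formula $\chi\in\mathrm{Th}_\exists(\mathcal{S},\mathbb{A})$ with rational coefficients such that $$\chi\text{ is valid}\iff(\varphi,\vec a)\text{ does not terminate on }F .$$ -/

import Mathlib

namespace LoopTermination

/-- The field of real algebraic numbers. -/
abbrev RealAlg : Type := algebraicClosure ℚ ℝ

/-! ### Propositional formulas over polynomial inequations -/

/-- Propositional formulas over the atoms `p ≥ 0` and `p > 0`, where `p` ranges over `P`. -/
inductive PropFormula (P : Type) : Type
  | tt : PropFormula P
  | ff : PropFormula P
  | ge (p : P) : PropFormula P
  | gt (p : P) : PropFormula P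
  | not (φ : PropFormula P) : PropFormula P
  | and (φ ψ : PropFormula P) : PropFormula P
  | or (φ ψ : PropFormula P) : PropFormula P

/-- Truth of a propositional formula, where `v p` is the value of the polynomial `p`. -/
def PropFormula.Holds {P : Type} (v : P → RealAlg) : PropFormula P → Prop
  | .tt => True
  | .ff => False
  | .ge p => 0 ≤ (v p : ℝ)
  | .gt p => 0 < (v p : ℝ)
  | .not φ => ¬ φ.Holds v
  | .and φ ψ => φ.Holds v ∧ ψ.Holds v
  | .or φ ψ => φ.Holds v ∨ ψ.Holds v

/-! ### Loops -/

/-- The loop `while guard do x ← update`, with `d` variables and real algebraic constants. -/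
structure PolyLoop (d : ℕ) where
  guard : PropFormula (MvPolynomial (Fin d) RealAlg)
  update : Fin d → MvPolynomial (Fin d) RealAlg

namespace PolyLoop

variable {d : ℕ}

/-- One execution of the loop body. -/
noncomputable def step (L : PolyLoop d) (c : Fin d → RealAlg) : Fin d → RealAlg :=
  fun i => MvPolynomial.eval c (L.update i)

/-- The loop condition holds at the point `c`. -/
def GuardHolds (L : PolyLoop d) (c : Fin d → RealAlg) : Prop :=
  L.guard.Holds (fun p => MvPolynomial.eval c p)

/-- There is no point of `F` from which the loop runs forever. -/
def TerminatesOn (L : PolyLoop d) (F : Set (Fin d → RealAlg)) : Prop :=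
  ¬ ∃ c ∈ F, ∀ n : ℕ, L.GuardHolds (L.step^[n] c)

/-- `F` is invariant under the update of the loop. -/
def Invariant (L : PolyLoop d) (F : Set (Fin d → RealAlg)) : Prop :=
  ∀ c ∈ F, L.step c ∈ F

/-- The dependency relation between the variables: the transitive closure of
`i ≠ j` and `x_j` occurs in the update of `x_i`. -/
def Dep (L : PolyLoop d) : Fin d → Fin d → Prop :=
  Relation.TransGen (fun i j => i ≠ j ∧ j ∈ (L.update i).vars)

/-- There is no infinite chain of dependencies. -/
def Triangular (L : PolyLoop d) : Prop :=
  WellFounded (fun j i => L.Dep i j)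

/-- No `x_i` occurs in a monomial of degree at least two of its own update. -/
def WeaklyNonlinear (L : PolyLoop d) : Prop :=
  ∀ i : Fin d, ∀ m ∈ (L.update i).support, m i ≠ 0 → m.degree ≤ 1

/-- Weakly non-linear, and `x_i` has a non-negative coefficient in its own update, for every `i`. -/
def Nonnegative (L : PolyLoop d) : Prop :=
  L.WeaklyNonlinear ∧
    ∀ i : Fin d, 0 ≤ ((MvPolynomial.coeff (Finsupp.single i 1) (L.update i) : RealAlg) : ℝ)

/-- Triangular weakly non-linear loops. -/
def IsTwn (L : PolyLoop d) : Prop := L.Triangular ∧ L.WeaklyNonlinear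

/-- Triangular non-negative loops. -/
def IsTnn (L : PolyLoop d) : Prop := L.Triangular ∧ L.Nonnegative

end PolyLoop

/-! ### The existential theory -/

/-- Formulas `∃ y' ∈ 𝔸 ^ algVars, ∃ y ∈ S ^ ringVars, matrix` with `m` free variables, where the
polynomials in the matrix have coefficients in `R`. The variables of the polynomials are listed in
the order `y'`, `y`, free variables. The ring `S` only enters in the semantics. -/
structure ExFormula (R : Type) [CommSemiring R] (m : ℕ) where
  algVars : ℕ
  ringVars : ℕ
  matrix : PropFormula (MvPolynomial (Fin (algVars + ringVars + m)) R)

/-- Truth of an existential formula at the values `c` of its free variables. -/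
def ExFormula.Holds {R : Type} [CommSemiring R] [Algebra R RealAlg] {m : ℕ}
    (S : Subring RealAlg) (ψ : ExFormula R m) (c : Fin m → RealAlg) : Prop :=
  ∃ y' : Fin ψ.algVars → RealAlg, ∃ y : Fin ψ.ringVars → RealAlg, (∀ i, y i ∈ S) ∧
    ψ.matrix.Holds (fun p => MvPolynomial.aeval (Fin.append (Fin.append y' y) c) p)

/-- Validity of a closed existential formula. -/
def ExFormula.Valid {R : Type} [CommSemiring R] [Algebra R RealAlg]
    (S : Subring RealAlg) (χ : ExFormula R 0) : Prop :=
  χ.Holds S Fin.elim0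

/-- The set `F` is defined by the formula `ψ`. -/
def ExFormula.Defines {R : Type} [CommSemiring R] [Algebra R RealAlg] {d : ℕ}
    (S : Subring RealAlg) (ψ : ExFormula R d) (F : Set (Fin d → RealAlg)) : Prop :=
  ∀ c : Fin d → RealAlg, c ∈ F ↔ ψ.Holds S c

/-! ### Finite representations of the inputs and outputs of algorithms -/

/-- The value at `x` of the polynomial with integer coefficients `l`, constant term first. -/
noncomputable def evalIntList (l : List ℤ) (x : ℝ) : ℝ :=
  l.foldr (fun (a : ℤ) (r : ℝ) => (a : ℝ) + x * r) 0

/-- A code `(l, a, b, m)` of a real algebraic number: the integer polynomial `l` and the rational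
open interval from `a / (m + 1)` to `b / (m + 1)`. -/
abbrev AlgCode : Type := List ℤ × ℤ × ℤ × ℕ

/-- `α` is the only real root of the polynomial in the interval. -/
def AlgCode.Represents (u : AlgCode) (α : RealAlg) : Prop :=
  ∀ x : ℝ, ((u.2.1 : ℝ) / ((u.2.2.2 : ℝ) + 1) < x ∧ x < (u.2.2.1 : ℝ) / ((u.2.2.2 : ℝ) + 1) ∧
    evalIntList u.1 x = 0) ↔ x = (α : ℝ)

/-- A code `(a, m)` of the rational number `a / (m + 1)`. -/
abbrev RatCode : Type := ℤ × ℕ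

def RatCode.Represents (u : RatCode) (q : ℚ) : Prop :=
  q = (u.1 : ℚ) / ((u.2 : ℚ) + 1)

/-- A polynomial is given as a list of monomials, each a coefficient with a vector of exponents. -/
abbrev PolyCode (κ : Type) : Type := List (κ × List ℕ)

/-- `rep u α` says that `u` is a code of the coefficient `α`. -/
inductive PolyCode.Represents {κ R : Type} [CommSemiring R] (rep : κ → R → Prop) {n : ℕ} :
    PolyCode κ → MvPolynomial (Fin n) R → Prop
  | nil : PolyCode.Represents rep [] 0
  | cons {u : κ} {α : R} {w : PolyCode κ} {p : MvPolynomial (Fin n) R} (m : Fin n →₀ ℕ) :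
      rep u α → PolyCode.Represents rep w p →
      PolyCode.Represents rep ((u, List.ofFn m) :: w) (MvPolynomial.monomial m α + p)

/-- A propositional formula is written in postfix notation. The symbols `0, 1, 2, 3, 4` are
`true`, `false`, `not`, `and`, `or`; an atom `p ≥ 0` is `(false, p)`, and `p > 0` is `(true, p)`. -/
abbrev PropCode (κ : Type) : Type := List (Fin 5 ⊕ Bool × PolyCode κ)

inductive PropCode.Represents {κ R : Type} [CommSemiring R] (rep : κ → R → Prop) {n : ℕ} :
    PropCode κ → PropFormula (MvPolynomial (Fin n) R) → Prop
  | tt : PropCode.Represents rep [Sum.inl 0] .tt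
  | ff : PropCode.Represents rep [Sum.inl 1] .ff
  | ge {w : PolyCode κ} {p : MvPolynomial (Fin n) R} :
      PolyCode.Represents rep w p → PropCode.Represents rep [Sum.inr (false, w)] (.ge p)
  | gt {w : PolyCode κ} {p : MvPolynomial (Fin n) R} :
      PolyCode.Represents rep w p → PropCode.Represents rep [Sum.inr (true, w)] (.gt p)
  | not {u : PropCode κ} {φ : PropFormula (MvPolynomial (Fin n) R)} :
      PropCode.Represents rep u φ → PropCode.Represents rep (u ++ [Sum.inl 2]) (.not φ)
  | and {u v : PropCode κ} {φ ψ : PropFormula (MvPolynomial (Fin n) R)} :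
      PropCode.Represents rep u φ → PropCode.Represents rep v ψ →
      PropCode.Represents rep (u ++ v ++ [Sum.inl 3]) (.and φ ψ)
  | or {u v : PropCode κ} {φ ψ : PropFormula (MvPolynomial (Fin n) R)} :
      PropCode.Represents rep u φ → PropCode.Represents rep v ψ →
      PropCode.Represents rep (u ++ v ++ [Sum.inl 4]) (.or φ ψ)

/-- The code of a loop: the list of the updates, and the loop condition. -/
abbrev LoopCode : Type := List (PolyCode AlgCode) × PropCode AlgCode

def LoopCode.Represents {d : ℕ} (u : LoopCode) (L : PolyLoop d) : Prop :=
  List.Forall₂ (PolyCode.Represents AlgCode.Represents) u.1 (List.ofFn L.update) ∧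
    PropCode.Represents AlgCode.Represents u.2 L.guard

/-- The code of an existential formula: the two numbers of quantified variables, and the matrix. -/
abbrev ExCode (κ : Type) : Type := ℕ × ℕ × PropCode κ

def ExCode.Represents {κ R : Type} [CommSemiring R] (rep : κ → R → Prop) {m : ℕ}
    (u : ExCode κ) (ψ : ExFormula R m) : Prop :=
  u.1 = ψ.algVars ∧ u.2.1 = ψ.ringVars ∧ PropCode.Represents rep u.2.2 ψ.matrix

/-! ### Reducibility -/

/-- Termination of the loops in the class `C`, on update-invariant sets that are definable in the
existential theory, is reducible to that theory: there is a computable function that maps a loop of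
the class and a formula defining an invariant set `F` to a closed formula with rational
coefficients, which is valid if and only if the loop does not terminate on `F`. -/
def TerminationReducible (S : Subring RealAlg) (C : ∀ d : ℕ, PolyLoop d → Prop) : Prop :=
  ∃ f : LoopCode × ExCode AlgCode → ExCode RatCode, Computable f ∧
    ∀ (d : ℕ) (L : PolyLoop d) (ψ : ExFormula RealAlg d) (F : Set (Fin d → RealAlg)),
      C d L → L.Invariant F → ψ.Defines S F →
      ∀ (u : LoopCode) (w : ExCode AlgCode),
        u.Represents L → ExCode.Represents AlgCode.Represents w ψ →
        ∃ χ : ExFormula ℚ 0, ExCode.Represents RatCode.Represents (f (u, w)) χ ∧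
          (χ.Valid S ↔ ¬ L.TerminatesOn F)

end LoopTermination

/-!
Every tnn-loop is a twn-loop, so one reduction for twn-loops serves both classes.

Since `F` is invariant, the loop does not terminate on `F` iff from some `c ∈ F` the loop condition
holds *eventually* (`IsWitness.not_terminatesOn`). Let `p` be a polynomial of the loop condition and
`u n` its value at the `n`-th point of the orbit of `c`. By triangularity and weak non-linearity,
every coordinate of the orbit satisfies `x (n + 1) = b * x n + q n`, where `q` is a polynomial
expression in coordinates that precede it. Sequences annihilated by a product of operators `E - b`,
with `E` the shift and `b` in the base field, are closed under sums, products and solutions of such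
equations, with explicit bounds on the number of factors (`SplitRecurrence`). Hence `u` is
annihilated by such a product, and a bound `N` on the number of its factors is computable from the
sizes of the polynomials alone (`PolyLoop.splitRecurrence_eval_orbit`, `exists_roots_orbit`). On the
even and on the odd points of the orbit separately the roots are squares, and after a shift by `N`
steps the root zero no longer matters. This leaves roots `0 < s 0 ≤ s 1 ≤ ⋯`
(`exists_sorted_roots`).

For such a sequence `v` the eventual sign is elementary: it is the sign of the last nonzero number
among the initial values of `∏ i < j, (E - s i)` applied to `v`, for `j < N`, because
`v (n + 1) = s * v n + w n` inherits the sign of `w` as soon as `w` dominates `s ^ n`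
(`eventually_signHolds_iff`).

The output therefore needs neither closed forms nor the order of the characteristic roots. It
quantifies existentially over the values of the coefficients (pinned down by their codes), the
variables of `ψ`, sufficiently many points of the orbit, and the roots `s i`. It says that the orbit
is one, that it starts in `F`, that the roots are positive and increasing, that
`∏ i < N, (E - s i)` applied to `v` vanishes at the first `N` places, and that the loop condition
holds with each atom replaced by the condition on its eventual sign. Vanishing at `N` places is
enough for any guess of the roots, since `v` satisfies some recurrence of order at most `N`
(`eq_zero_of_initial`).

Variables are numbered by pairing, and the sizes of the input are bounded by its Gödel number. So
the output is produced by list operations, which makes the reduction primitive recursive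
(`primrec_nonterminationCode`), and `means_matrixCode` says what the output means.
-/

namespace LoopTermination

open Filter Encodable

/-! ### Eventual signs of linear recurrence sequences -/

theorem prod_range_getD {α M : Type*} [CommMonoid M] (l : List α) (f : α → M) (d : α) :
    ∏ i ∈ Finset.range l.length, f (l.getD i d) = (l.map f).prod := by
  induction l with
  | nil => simp
  | cons a l ih => simp [Finset.prod_range_succ', mul_comm, ← ih]

section Signs

variable {K : Type*} [Field K]

/-- The value at `n` of the sequence `(E + m (j - 1)) ⋯ (E + m 0) u`, where `E` is the shift. -/
def iterDiff (m : ℕ → K) : ℕ → (ℕ → K) → ℕ → K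
  | 0, u, n => u n
  | j + 1, u, n => iterDiff m j u (n + 1) + m j * iterDiff m j u n

theorem iterDiff_congr {m m' u v : ℕ → K} (j n : ℕ) (hm : ∀ i < j, m i = m' i)
    (h : ∀ i ≤ j, u (n + i) = v (n + i)) : iterDiff m j u n = iterDiff m' j v n := by
  induction j generalizing n with
  | zero => exact h 0 le_rfl
  | succ j ih =>
    have hm' := fun i (hi : i < j) => hm i (by omega)
    simp only [iterDiff]
    rw [ih (n + 1) hm' fun i hi => ?_, ih n hm' fun i hi => h i (by omega), hm j (by omega)]
    have := h (i + 1) (by omega)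
    rwa [show n + (i + 1) = n + 1 + i by ring] at this

theorem iterDiff_shift (m : ℕ → K) (u : ℕ → K) (k j n : ℕ) :
    iterDiff m j (fun i => u (i + k)) n = iterDiff m j u (n + k) := by
  induction j generalizing n with
  | zero => rfl
  | succ j ih => simp only [iterDiff, ih]; congr 2; ring

theorem iterDiff_neg (m : ℕ → K) (u : ℕ → K) (j n : ℕ) :
    iterDiff m j (fun i => - u i) n = - iterDiff m j u n := by
  induction j generalizing n with
  | zero => rfl
  | succ j ih => simp only [iterDiff, ih]; ring

theorem iterDiff_eq_zero_of_initial (m : ℕ → K) (u : ℕ → K) {j N : ℕ} (hjN : j ≤ N)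
    (hN : ∀ n, iterDiff m N u n = 0) (h : ∀ i < N, j ≤ i → iterDiff m i u 0 = 0) (n : ℕ) :
    iterDiff m j u n = 0 := by
  induction hjN using Nat.decreasingInduction generalizing n with
  | self => exact hN n
  | of_succ j hj ih =>
    have ih' := ih fun i hi hji => h i hi (by omega)
    induction n with
    | zero => exact h j hj le_rfl
    | succ n ihn =>
      have := ih' n
      simp only [iterDiff, ihn, mul_zero, add_zero] at this
      exact this

variable [LinearOrder K]

/-- The comparison of a number with zero that an atom `p > 0` (for `true`) or `p ≥ 0` (for `false`)
requires. -/
def SignHolds (b : Bool) (x : K) : Prop :=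
  bif b then 0 < x else 0 ≤ x

/-- The sign condition `SignHolds b` on the last nonzero entry among `U 0, …, U (N - 1)`, or on zero
if there is none. -/
def LastSign (b : Bool) (U : ℕ → K) : ℕ → Prop
  | 0 => SignHolds b (0 : K)
  | j + 1 => 0 < U j ∨ (0 ≤ U j ∧ LastSign b U j)

theorem lastSign_of_forall_eq_zero (b : Bool) {U : ℕ → K} {N : ℕ} (h : ∀ j < N, U j = 0) :
    LastSign b U N ↔ SignHolds b (0 : K) := by
  induction N with
  | zero => rfl
  | succ N ih =>
    simp [LastSign, h N (by omega), ih fun j hj => h j (by omega)]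

theorem lastSign_iff_of_last (b : Bool) {U : ℕ → K} {j N : ℕ} (hj : j < N) (hne : U j ≠ 0)
    (h : ∀ i < N, j < i → U i = 0) : LastSign b U N ↔ 0 < U j := by
  induction N with
  | zero => omega
  | succ N ih =>
    rcases Nat.lt_succ_iff_lt_or_eq.1 hj with hlt | rfl
    · simp [LastSign, h N (by omega) hlt, ih hlt fun i hi => h i (by omega)]
    · simp only [LastSign]
      constructor
      · rintro (h' | h')
        · exact h'
        · exact lt_of_le_of_ne h'.1 hne.symm
      · exact Or.inl

theorem exists_last_ne_zero (U : ℕ → K) (N : ℕ) :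
    (∀ j < N, U j = 0) ∨ ∃ j < N, U j ≠ 0 ∧ ∀ i < N, j < i → U i = 0 := by
  induction N with
  | zero => left; simp
  | succ N ih =>
    by_cases h : U N = 0
    · rcases ih with ih | ⟨j, hj, hne, hz⟩
      · left
        intro j hj
        rcases Nat.lt_succ_iff_lt_or_eq.1 hj with hlt | rfl
        exacts [ih j hlt, h]
      · refine Or.inr ⟨j, by omega, hne, fun i hi hji => ?_⟩
        rcases Nat.lt_succ_iff_lt_or_eq.1 hi with hlt | rfl
        exacts [hz i hlt hji, h]
    · exact Or.inr ⟨N, by omega, h, fun i hi hi' => by omega⟩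

variable [IsStrictOrderedRing K] [Archimedean K]

/-- If `v n` dominates `s ^ n`, then so does every solution `u` of `u (n + 1) = s * u n + v n`,
since `u n / s ^ n` grows at least linearly. -/
theorem eventually_le_of_recurrence {s : K} (hs : 0 < s) {u v : ℕ → K}
    (hrec : ∀ n, u (n + 1) = s * u n + v n) {ε : K} (hε : 0 < ε)
    (hv : ∀ᶠ n in atTop, ε * s ^ n ≤ v n) : ∀ᶠ n in atTop, 1 * s ^ n ≤ u n := by
  obtain ⟨n₀, hn₀⟩ := eventually_atTop.1 hv
  have key : ∀ k : ℕ, (u n₀ / s ^ n₀ + k * (ε / s)) * s ^ (n₀ + k) ≤ u (n₀ + k) := by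
    intro k
    induction k with
    | zero => simp [(pow_pos hs n₀).ne']
    | succ k ih =>
      rw [← add_assoc, hrec]
      have h1 := hn₀ (n₀ + k) (by omega)
      have h2 := mul_le_mul_of_nonneg_left ih hs.le
      have h3 : (u n₀ / s ^ n₀ + ((k + 1 : ℕ) : K) * (ε / s)) * s ^ (n₀ + k + 1) =
          s * ((u n₀ / s ^ n₀ + k * (ε / s)) * s ^ (n₀ + k)) + ε * s ^ (n₀ + k) := by
        push_cast
        field_simp
        ring
      rw [h3]
      exact add_le_add h2 h1
  obtain ⟨k₀, hk₀⟩ := Archimedean.arch (1 - u n₀ / s ^ n₀) (div_pos hε hs)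
  refine eventually_atTop.2 ⟨n₀ + k₀, fun n hn => ?_⟩
  obtain ⟨k, rfl⟩ := Nat.exists_eq_add_of_le (show n₀ ≤ n by omega)
  refine le_trans (mul_le_mul_of_nonneg_right ?_ (pow_pos hs _).le) (key k)
  have : (k₀ : K) * (ε / s) ≤ k * (ε / s) :=
    mul_le_mul_of_nonneg_right (by exact_mod_cast (by omega : k₀ ≤ k)) (div_pos hε hs).le
  rw [nsmul_eq_mul] at hk₀
  linarith

theorem eventually_pos_of_iterDiff_pos {m : ℕ → K} {u : ℕ → K} {j N : ℕ} (hj : j < N)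
    (hneg : ∀ i < N, m i < 0) (hmono : ∀ i, i + 1 < N → m (i + 1) ≤ m i)
    (hzero : ∀ n, iterDiff m (j + 1) u n = 0) (hpos : 0 < iterDiff m j u 0) :
    ∀ᶠ n in atTop, 0 < u n := by
  -- The lower bound `ε * (-m i) ^ n` passes from index `i + 1` to `i` because `-m` is increasing.
  have key : ∀ i ≤ j, ∃ ε > 0, ∀ᶠ n in atTop, ε * (- m i) ^ n ≤ iterDiff m i u n := by
    intro i hi
    induction hi using Nat.decreasingInduction with
    | self =>
      refine ⟨_, hpos, Eventually.of_forall fun n => ?_⟩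
      induction n with
      | zero => simp
      | succ n ih =>
        have h1 := hzero n
        simp only [iterDiff] at h1
        have h2 := mul_le_mul_of_nonneg_left ih (neg_nonneg.2 (hneg j hj).le)
        rw [pow_succ]
        linarith
    | of_succ i hi ih =>
      obtain ⟨ε, hε, h⟩ := ih
      have hs : 0 < - m i := neg_pos.2 (hneg i (by omega))
      refine ⟨1, one_pos, eventually_le_of_recurrence hs (v := iterDiff m (i + 1) u)
        (fun n => by simp only [iterDiff]; ring) hε ?_⟩
      filter_upwards [h] with n hn
      refine le_trans (mul_le_mul_of_nonneg_left (pow_le_pow_left₀ hs.le ?_ n) hε.le) hn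
      exact neg_le_neg (hmono i (by omega))
  obtain ⟨ε, hε, h⟩ := key 0 (Nat.zero_le j)
  filter_upwards [h] with n hn
  exact lt_of_lt_of_le (mul_pos hε (pow_pos (neg_pos.2 (hneg 0 (by omega))) n)) hn

/-- The eventual sign of a sequence annihilated by `∏ (E - s i)` with `0 < s 0 ≤ s 1 ≤ ⋯` is the
sign of the last nonzero number among the initial values of `∏ i < j, (E - s i)` applied to it. -/
theorem eventually_signHolds_iff {m : ℕ → K} {u : ℕ → K} {N : ℕ}
    (hneg : ∀ i < N, m i < 0) (hmono : ∀ i, i + 1 < N → m (i + 1) ≤ m i)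
    (hzero : ∀ n, iterDiff m N u n = 0) (b : Bool) :
    ∀ᶠ n in atTop, (SignHolds b (u n) ↔ LastSign b (fun j => iterDiff m j u 0) N) := by
  rcases exists_last_ne_zero (fun j => iterDiff m j u 0) N with h | ⟨j, hj, hne, h⟩
  · refine Eventually.of_forall fun n => ?_
    rw [lastSign_of_forall_eq_zero b h,
      show u n = 0 from iterDiff_eq_zero_of_initial m u (Nat.zero_le N) hzero
        (fun i hi _ => h i hi) n]
  · have hz : ∀ n, iterDiff m (j + 1) u n = 0 :=
      iterDiff_eq_zero_of_initial m u hj hzero fun i hi hji => h i hi hji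
    rw [lastSign_iff_of_last b hj hne h]
    rcases lt_or_gt_of_ne hne with hlt | hgt
    · have := eventually_pos_of_iterDiff_pos (u := fun i => - u i) hj hneg hmono
        (fun n => by rw [iterDiff_neg, hz, neg_zero]) (by rw [iterDiff_neg]; exact neg_pos.2 hlt)
      filter_upwards [this] with n hn
      have hn' : u n < 0 := neg_pos.1 hn
      have hL : ¬ 0 < iterDiff m j u 0 := hlt.not_gt
      cases b
      · exact iff_of_false hn'.not_ge hL
      · exact iff_of_false hn'.not_gt hL
    · filter_upwards [eventually_pos_of_iterDiff_pos hj hneg hmono hz hgt] with n hn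
      cases b
      · exact iff_of_true hn.le hgt
      · exact iff_of_true hn hgt

end Signs

/-! ### Recurrences whose characteristic roots lie in the base field -/

section Recurrences

open Polynomial

variable {K : Type*} [Field K]

/-- The shift operator on sequences. -/
def shift (K : Type*) [Field K] : Module.End K (ℕ → K) :=
  LinearMap.funLeft K K Nat.succ

@[simp]
theorem shift_apply (u : ℕ → K) (n : ℕ) : shift K u n = u (n + 1) := rfl

/-- The polynomial with the given list of roots. -/
noncomputable def rootPoly (bs : List K) : K[X] :=
  (bs.map fun b => X - C b).prod

/-- The polynomial `f`, evaluated at the shift operator, annihilates the sequence `u`. -/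
def Annihilates (f : K[X]) (u : ℕ → K) : Prop :=
  aeval (shift K) f u = 0

theorem Annihilates.mul_left {f : K[X]} {u : ℕ → K} (h : Annihilates f u) (g : K[X]) :
    Annihilates (g * f) u := by
  rw [Annihilates, map_mul, Module.End.mul_apply, h, map_zero]

theorem Annihilates.of_dvd {f g : K[X]} {u : ℕ → K} (h : Annihilates f u) (hfg : f ∣ g) :
    Annihilates g u := by
  obtain ⟨k, rfl⟩ := hfg
  rw [mul_comm]
  exact h.mul_left k

theorem annihilates_mul_iff {f g : K[X]} {u : ℕ → K} :
    Annihilates (f * g) u ↔ Annihilates f (aeval (shift K) g u) := by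
  rw [Annihilates, map_mul, Module.End.mul_apply, Annihilates]

theorem Annihilates.add {f : K[X]} {u v : ℕ → K} (hu : Annihilates f u) (hv : Annihilates f v) :
    Annihilates f (u + v) := by
  rw [Annihilates, map_add, hu, hv, add_zero]

theorem Annihilates.smul {f : K[X]} {u : ℕ → K} (hu : Annihilates f u) (c : K) :
    Annihilates f (c • u) := by
  rw [Annihilates, map_smul, hu, smul_zero]

theorem Annihilates.aeval {f : K[X]} {u : ℕ → K} (hu : Annihilates f u) (g : K[X]) :
    Annihilates f (aeval (shift K) g u) := by
  rw [← annihilates_mul_iff, mul_comm]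
  exact hu.mul_left g

theorem aeval_shift_X_pow (k : ℕ) (u : ℕ → K) :
    aeval (shift K) (X ^ k : K[X]) u = fun n => u (n + k) := by
  induction k generalizing u with
  | zero => simp
  | succ k ih =>
    rw [pow_succ, map_mul, Module.End.mul_apply, ih, aeval_X]
    funext n
    simp [add_assoc]

theorem aeval_shift_X_sub_C (b : K) (u : ℕ → K) (n : ℕ) :
    aeval (shift K) (X - C b) u n = u (n + 1) - b * u n := by
  simp [Module.algebraMap_end_apply]

theorem aeval_shift_prod (m : ℕ → K) (u : ℕ → K) (j : ℕ) :
    aeval (shift K) (∏ i ∈ Finset.range j, (X + C (m i))) u = iterDiff m j u := by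
  induction j with
  | zero => funext n; simp [iterDiff]
  | succ j ih =>
    rw [Finset.prod_range_succ, mul_comm, map_mul, Module.End.mul_apply, ih]
    funext n
    simp [Module.algebraMap_end_apply, iterDiff]

@[simp]
theorem rootPoly_cons (b : K) (bs : List K) : rootPoly (b :: bs) = (X - C b) * rootPoly bs := rfl

@[simp]
theorem rootPoly_nil : rootPoly ([] : List K) = 1 := rfl

theorem rootPoly_append (bs cs : List K) : rootPoly (bs ++ cs) = rootPoly bs * rootPoly cs := by
  simp [rootPoly]

theorem annihilates_one_iff {u : ℕ → K} : Annihilates (1 : K[X]) u ↔ u = 0 := by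
  simp [Annihilates]

/-- A sequence with a recurrence of order at most `N` is determined by its first `N` values. -/
theorem eq_zero_of_initial {bs : List K} {N : ℕ} (hN : bs.length ≤ N) {u : ℕ → K}
    (hu : Annihilates (rootPoly bs) u) (h : ∀ n < N, u n = 0) : u = 0 := by
  induction bs generalizing u N with
  | nil => exact annihilates_one_iff.1 hu
  | cons b bs ih =>
    rw [rootPoly_cons, mul_comm, annihilates_mul_iff] at hu
    rw [List.length_cons] at hN
    have h0 := ih (N := N - 1) (by omega) hu fun n hn => by
      rw [aeval_shift_X_sub_C, h _ (by omega), h _ (by omega), mul_zero, sub_zero]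
    funext n
    induction n with
    | zero => exact h 0 (by omega)
    | succ n ihn =>
      have := congrFun h0 n
      rw [aeval_shift_X_sub_C, ihn] at this
      simpa using this

/-- The list of all products of an element of `bs` and an element of `cs`. -/
def prodRoots (bs cs : List K) : List K :=
  bs.flatMap fun b => cs.map (b * ·)

theorem length_prodRoots (bs cs : List K) :
    (prodRoots bs cs).length = bs.length * cs.length := by
  simp [prodRoots, List.length_flatMap]

theorem rootPoly_prodRoots_cons_dvd (bs cs : List K) (c : K) :
    rootPoly (prodRoots bs cs) ∣ rootPoly (prodRoots bs (c :: cs)) := by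
  induction bs with
  | nil => simp [prodRoots]
  | cons b bs ih =>
    have h : ∀ ds, prodRoots (b :: bs) ds = ds.map (b * ·) ++ prodRoots bs ds := fun _ => rfl
    rw [h, h, rootPoly_append, rootPoly_append, List.map_cons, rootPoly_cons, mul_assoc]
    exact (mul_dvd_mul_left _ ih).mul_left _

/-- The roots of a product of two sequences are products of their roots, by
`(E - bc)(uv) = (E - b)u ⋅ Ev + b u ⋅ (E - c)v`. -/
theorem Annihilates.mul_prodRoots {bs cs : List K} {u v : ℕ → K}
    (hu : Annihilates (rootPoly bs) u) (hv : Annihilates (rootPoly cs) v) :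
    Annihilates (rootPoly (prodRoots bs cs)) (u * v) := by
  induction bs generalizing u v cs with
  | nil =>
    rw [annihilates_one_iff.1 hu, zero_mul]
    exact map_zero _
  | cons b bs ihb =>
    induction cs generalizing u v with
    | nil =>
      rw [annihilates_one_iff.1 hv, mul_zero]
      exact map_zero _
    | cons c cs ihc =>
      have h : ∀ ds, prodRoots (b :: bs) ds = ds.map (b * ·) ++ prodRoots bs ds := fun _ => rfl
      have hu' := hu
      have hv' := hv
      rw [rootPoly_cons, mul_comm, annihilates_mul_iff] at hu' hv'
      have hEv := hv.aeval (X : K[X])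
      have h1 := ihb hu' hEv
      have h2 := ihc hu hv'
      rw [h, List.map_cons, List.cons_append, rootPoly_cons, mul_comm, annihilates_mul_iff]
      have key : Polynomial.aeval (shift K) (X - C (b * c)) (u * v) =
          Polynomial.aeval (shift K) (X - C b) u * Polynomial.aeval (shift K) (X : K[X]) v +
            b • (u * Polynomial.aeval (shift K) (X - C c) v) := by
        funext n
        simp only [Pi.add_apply, Pi.mul_apply, Pi.smul_apply, smul_eq_mul, aeval_shift_X_sub_C,
          aeval_X, shift_apply]
        ring
      rw [key]
      refine (h1.of_dvd ?_).add ((h2.of_dvd ?_).smul b)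
      · rw [rootPoly_append]
        exact dvd_mul_left _ _
      · rw [h, rootPoly_append, rootPoly_append]
        exact mul_dvd_mul_left _ (rootPoly_prodRoots_cons_dvd _ _ _)

/-- The sequence `u` is annihilated by a product of at most `k` operators `E - b` with `b` in the
base field. -/
def SplitRecurrence (k : ℕ) (u : ℕ → K) : Prop :=
  ∃ bs : List K, bs.length ≤ k ∧ Annihilates (rootPoly bs) u

theorem SplitRecurrence.mono {k l : ℕ} {u : ℕ → K} (h : SplitRecurrence k u) (hkl : k ≤ l) :
    SplitRecurrence l u :=
  let ⟨bs, hbs, hu⟩ := h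
  ⟨bs, hbs.trans hkl, hu⟩

theorem splitRecurrence_zero (k : ℕ) : SplitRecurrence k (0 : ℕ → K) :=
  ⟨[], Nat.zero_le k, map_zero _⟩

theorem splitRecurrence_const (c : K) : SplitRecurrence 1 (fun _ => c) := by
  refine ⟨[1], le_rfl, ?_⟩
  rw [rootPoly_cons, rootPoly_nil, mul_one, Annihilates]
  funext n
  simp

theorem splitRecurrence_one : SplitRecurrence 1 (1 : ℕ → K) := splitRecurrence_const 1

theorem SplitRecurrence.add {k l : ℕ} {u v : ℕ → K} (hu : SplitRecurrence k u)
    (hv : SplitRecurrence l v) : SplitRecurrence (k + l) (u + v) := by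
  obtain ⟨bs, hbs, hu⟩ := hu
  obtain ⟨cs, hcs, hv⟩ := hv
  refine ⟨bs ++ cs, by simpa using add_le_add hbs hcs, ?_⟩
  rw [rootPoly_append]
  exact (hu.of_dvd (dvd_mul_right _ _)).add (hv.of_dvd (dvd_mul_left _ _))

theorem SplitRecurrence.mul {k l : ℕ} {u v : ℕ → K} (hu : SplitRecurrence k u)
    (hv : SplitRecurrence l v) : SplitRecurrence (k * l) (u * v) := by
  obtain ⟨bs, hbs, hu⟩ := hu
  obtain ⟨cs, hcs, hv⟩ := hv
  exact ⟨prodRoots bs cs, by rw [length_prodRoots]; exact Nat.mul_le_mul hbs hcs,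
    hu.mul_prodRoots hv⟩

theorem SplitRecurrence.pow {k : ℕ} {u : ℕ → K} (hu : SplitRecurrence k u) (e : ℕ) :
    SplitRecurrence (k ^ e) (u ^ e) := by
  induction e with
  | zero => simpa only [pow_zero] using splitRecurrence_one (K := K)
  | succ e ih => simpa only [pow_succ] using ih.mul hu

theorem SplitRecurrence.sum {ι : Type*} (s : Finset ι) {k : ℕ} {u : ι → ℕ → K}
    (h : ∀ i ∈ s, SplitRecurrence k (u i)) : SplitRecurrence (s.card * k) (∑ i ∈ s, u i) := by
  classical
  induction s using Finset.induction_on with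
  | empty => simpa using splitRecurrence_zero (K := K) 0
  | insert a s ha ih =>
    rw [Finset.sum_insert ha, Finset.card_insert_of_notMem ha, add_one_mul, add_comm (u a)]
    exact (ih fun i hi => h i (Finset.mem_insert_of_mem hi)).add (h a (Finset.mem_insert_self a s))

theorem SplitRecurrence.prod_pow {ι : Type*} (s : Finset ι) {k : ℕ} {u : ι → ℕ → K} (e : ι → ℕ)
    (h : ∀ i ∈ s, SplitRecurrence k (u i)) :
    SplitRecurrence (k ^ ∑ i ∈ s, e i) (∏ i ∈ s, u i ^ e i) := by
  classical
  induction s using Finset.induction_on with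
  | empty =>
    simpa only [Finset.sum_empty, pow_zero, Finset.prod_empty] using splitRecurrence_one (K := K)
  | insert a s ha ih =>
    rw [Finset.sum_insert ha, Finset.prod_insert ha, pow_add]
    exact ((h a (Finset.mem_insert_self a s)).pow _).mul
      (ih fun i hi => h i (Finset.mem_insert_of_mem hi))

theorem SplitRecurrence.of_recurrence {k : ℕ} {u v : ℕ → K} (hv : SplitRecurrence k v) (b : K)
    (h : ∀ n, u (n + 1) = b * u n + v n) : SplitRecurrence (k + 1) u := by
  obtain ⟨bs, hbs, hv⟩ := hv
  refine ⟨b :: bs, by simpa using hbs, ?_⟩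
  rw [rootPoly_cons, mul_comm, annihilates_mul_iff]
  convert hv using 1
  funext n
  rw [aeval_shift_X_sub_C, h]
  ring

/-- The shift acts on the even places of a sequence as its square acts on the sequence. -/
theorem aeval_shift_subsequence (f : K[X]) (u : ℕ → K) :
    aeval (shift K) f (fun n => u (2 * n)) =
      fun n => aeval (shift K) (f.comp (X ^ 2)) u (2 * n) := by
  induction f using Polynomial.induction_on' with
  | add p q hp hq =>
    rw [map_add, LinearMap.add_apply, hp, hq, add_comp, map_add, LinearMap.add_apply]
    rfl
  | monomial k a =>
    rw [← C_mul_X_pow_eq_monomial, mul_comp, C_comp, pow_comp, X_comp, ← pow_mul, map_mul, map_mul,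
      Module.End.mul_apply, Module.End.mul_apply, aeval_shift_X_pow, aeval_shift_X_pow]
    funext n
    simp [Module.algebraMap_end_apply, mul_add]

theorem Annihilates.subsequence {bs : List K} {u : ℕ → K} (h : Annihilates (rootPoly bs) u) :
    Annihilates (rootPoly (bs.map (· ^ 2))) (fun n => u (2 * n)) := by
  have hdvd : rootPoly bs ∣ (rootPoly (bs.map (· ^ 2))).comp (X ^ 2) := by
    clear h
    induction bs with
    | nil => simp
    | cons b bs ih =>
      rw [List.map_cons, rootPoly_cons, rootPoly_cons, mul_comp]
      refine mul_dvd_mul ⟨X + C b, ?_⟩ ih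
      rw [sub_comp, X_comp, C_comp, C_pow]
      ring
  rw [Annihilates, aeval_shift_subsequence, (show Polynomial.aeval (shift K) _ u = 0 from
    h.of_dvd hdvd)]
  rfl

theorem Annihilates.shift {f : K[X]} {u : ℕ → K} (h : Annihilates f u) (k : ℕ) :
    Annihilates f (fun n => u (n + k)) := by
  rw [← aeval_shift_X_pow]
  exact h.aeval _

theorem rootPoly_dvd_of_filter [DecidableEq K] (bs : List K) :
    rootPoly bs ∣ X ^ bs.length * rootPoly (bs.filter (· ≠ 0)) := by
  induction bs with
  | nil => simp
  | cons b bs ih =>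
    by_cases hb : b = 0
    · rw [List.filter_cons_of_neg (by simpa using hb), hb, rootPoly_cons, C_0, sub_zero,
        List.length_cons, pow_succ', mul_assoc]
      exact mul_dvd_mul_left _ ih
    · rw [List.filter_cons_of_pos (by simpa using hb), rootPoly_cons, rootPoly_cons,
        List.length_cons, pow_succ, show ∀ p q r s : K[X], p * q * (r * s) = r * q * (p * s) by
          intros; ring, mul_assoc]
      exact mul_dvd_mul_left _ (ih.mul_left _)

/-- A split recurrence with nonnegative roots can be rewritten, after a shift that removes the zero
roots, as a recurrence with a prescribed number of positive roots in increasing order. -/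
theorem exists_sorted_roots [LinearOrder K] [IsStrictOrderedRing K] {bs : List K}
    (hbs : ∀ b ∈ bs, 0 ≤ b) {N : ℕ} (hN : bs.length ≤ N) :
    ∃ m : ℕ → K, (∀ i < N, m i < 0) ∧ (∀ i, i + 1 < N → m (i + 1) ≤ m i) ∧
      ∀ u : ℕ → K, Annihilates (rootPoly bs) u → ∀ k ≥ N, ∀ n,
        iterDiff m N (fun i => u (i + k)) n = 0 := by
  set cs := bs.filter (· ≠ 0) with hcs
  have hlen : cs.length ≤ N := (List.length_filter_le _ _).trans hN
  -- The missing roots are filled up with the arbitrary positive number `1`.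
  set ds := (cs ++ List.replicate (N - cs.length) 1).insertionSort (· ≤ ·) with hds
  have hperm : ds.Perm (cs ++ List.replicate (N - cs.length) 1) := List.perm_insertionSort _ _
  have hsort : ds.Pairwise (· ≤ ·) := List.pairwise_insertionSort _ _
  have hdslen : ds.length = N := by rw [hperm.length_eq]; simp [hlen]
  have hpos : ∀ x ∈ ds, 0 < x := by
    intro x hx
    rw [hperm.mem_iff, List.mem_append, List.mem_replicate] at hx
    rcases hx with hx | hx
    · rw [hcs, List.mem_filter] at hx
      exact lt_of_le_of_ne (hbs x hx.1) (Ne.symm (by simpa using hx.2))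
    · exact hx.2 ▸ one_pos
  have hget : ∀ i (hi : i < ds.length), ds.getD i 1 = ds[i] := fun i hi => by
    simp [List.getD_eq_getElem?_getD, hi]
  refine ⟨fun i => - ds.getD i 1, fun i hi => ?_, fun i hi => ?_, fun u hu k hk n => ?_⟩
  · simp only [hget i (by omega : i < ds.length)]
    exact neg_neg_of_pos (hpos _ (List.getElem_mem _))
  · simp only [hget i (by omega : i < ds.length), hget (i + 1) (by omega : i + 1 < ds.length)]
    exact neg_le_neg (List.pairwise_iff_getElem.1 hsort i (i + 1) _ _ (by omega))
  · have hprod : ∏ i ∈ Finset.range N, (X + C (- ds.getD i 1)) = rootPoly ds := by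
      rw [rootPoly, ← prod_range_getD ds (fun b => X - C b) 1, hdslen]
      exact Finset.prod_congr rfl fun i _ => by rw [C_neg, sub_eq_add_neg]
    have hds' : rootPoly ds = rootPoly cs * rootPoly (List.replicate (N - cs.length) 1) := by
      rw [← rootPoly_append]
      exact (hperm.map _).prod_eq
    have hdvd : rootPoly bs ∣ rootPoly ds * X ^ k := by
      rw [hds', mul_comm _ (X ^ k)]
      refine (rootPoly_dvd_of_filter bs).trans ?_
      exact mul_dvd_mul (pow_dvd_pow _ (hN.trans hk)) (dvd_mul_right _ _)
    have := hu.of_dvd hdvd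
    rw [annihilates_mul_iff, aeval_shift_X_pow, Annihilates, ← hprod, aeval_shift_prod] at this
    exact congrFun this n

end Recurrences

/-! ### Orbits of triangular weakly non-linear loops -/

/-- The bound `B` limits both the number of monomials of `p` and their degrees. -/
def SizeLE {R : Type*} [CommSemiring R] {d : ℕ} (B : ℕ) (p : MvPolynomial (Fin d) R) : Prop :=
  p.support.card ≤ B ∧ ∀ m ∈ p.support, m.degree ≤ B

/-- A bound on the order of the recurrence of a variable with fewer than `k` dependencies, if the
updates have size at most `B`. -/
def orderBound (B k : ℕ) : ℕ :=
  Nat.rec 1 (fun _ r => 1 + B * r ^ B) k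

theorem orderBound_succ (B k : ℕ) : orderBound B (k + 1) = 1 + B * orderBound B k ^ B := rfl

theorem one_le_orderBound (B k : ℕ) : 1 ≤ orderBound B k := by
  cases k with
  | zero => exact le_rfl
  | succ k => rw [orderBound_succ]; omega

theorem orderBound_mono {B : ℕ} (hB : 1 ≤ B) : Monotone (orderBound B) := by
  refine monotone_nat_of_le_succ fun k => ?_
  rw [orderBound_succ]
  calc orderBound B k = orderBound B k ^ 1 := (pow_one _).symm
    _ ≤ orderBound B k ^ B := Nat.pow_le_pow_right (one_le_orderBound B k) hB
    _ ≤ B * orderBound B k ^ B := Nat.le_mul_of_pos_left _ hB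
    _ ≤ _ := Nat.le_add_left _ _

theorem splitRecurrence_monomials {K : Type*} [Field K] {d B k : ℕ} (hk : 1 ≤ k)
    (x : Fin d → ℕ → K) (s : Finset (Fin d →₀ ℕ)) (a : (Fin d →₀ ℕ) → K)
    (hB : s.card ≤ B) (hdeg : ∀ m ∈ s, m.degree ≤ B)
    (hx : ∀ m ∈ s, ∀ i, m i ≠ 0 → SplitRecurrence k (x i)) :
    SplitRecurrence (B * k ^ B) (fun n => ∑ m ∈ s, a m * ∏ i, x i n ^ m i) := by
  have h : (fun n => ∑ m ∈ s, a m * ∏ i, x i n ^ m i) =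
      ∑ m ∈ s, a m • ∏ i ∈ m.support, x i ^ m i := by
    funext n
    simp only [Finset.sum_apply, Pi.smul_apply, Finset.prod_apply, Pi.pow_apply, smul_eq_mul]
    refine Finset.sum_congr rfl fun m _ => congrArg _ ?_
    refine (Finset.prod_subset (Finset.subset_univ _) fun i _ hi => ?_).symm
    rw [Finsupp.notMem_support_iff.1 hi, pow_zero]
  rw [h]
  refine (SplitRecurrence.sum s (k := k ^ B) fun m hm => ?_).mono (Nat.mul_le_mul_right _ hB)
  obtain ⟨bs, hbs, hu⟩ := (SplitRecurrence.prod_pow m.support m fun i hi =>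
    hx m hm i (Finsupp.mem_support_iff.1 hi)).mono (Nat.pow_le_pow_right hk (hdeg m hm))
  exact ⟨bs, hbs, hu.smul _⟩

namespace PolyLoop

variable {d : ℕ}

open Classical in
/-- The number of variables on which the variable `i` depends. -/
noncomputable def depCount (L : PolyLoop d) (i : Fin d) : ℕ :=
  (Finset.univ.filter (L.Dep i)).card

theorem depCount_le (L : PolyLoop d) (i : Fin d) : L.depCount i ≤ d := by
  classical
  simpa [depCount] using Finset.card_le_univ (Finset.univ.filter (L.Dep i))

theorem depCount_lt {L : PolyLoop d} (hL : L.Triangular) {i j : Fin d} (h : L.Dep i j) :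
    L.depCount j < L.depCount i := by
  classical
  refine Finset.card_lt_card (Finset.ssubset_iff_of_subset ?_ |>.2 ⟨j, by simpa using h, ?_⟩)
  · intro k hk
    simp only [Finset.mem_filter, Finset.mem_univ, true_and] at hk ⊢
    exact h.trans hk
  · simp only [Finset.mem_filter, Finset.mem_univ, true_and]
    exact fun hjj => hL.asymmetric _ _ hjj hjj

theorem step_iterate_succ_apply (L : PolyLoop d) (c : Fin d → RealAlg) (n : ℕ) (i : Fin d) :
    L.step^[n + 1] c i = MvPolynomial.eval (L.step^[n] c) (L.update i) := by
  rw [Function.iterate_succ_apply']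
  rfl

/-- In the update of `x_i` the only monomial with `x_i` is linear, so the values of `x_i` satisfy an
inhomogeneous linear recurrence of order one over the variables on which `x_i` depends. -/
theorem splitRecurrence_orbit {L : PolyLoop d} (hL : L.IsTwn) {B : ℕ} (hB : 1 ≤ B)
    (hsize : ∀ i, SizeLE B (L.update i)) (c : Fin d → RealAlg) (i : Fin d) :
    SplitRecurrence (orderBound B (L.depCount i + 1)) (fun n => L.step^[n] c i) := by
  induction hk : L.depCount i using Nat.strong_induction_on generalizing i with
  | _ k ih =>
    subst hk
    set p := L.update i with hp
    set s := p.support.filter (fun m => m i = 0) with hs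
    have hrest : SplitRecurrence (B * orderBound B (L.depCount i) ^ B)
        (fun n => ∑ m ∈ s, p.coeff m * ∏ j, (fun n => L.step^[n] c j) n ^ m j) := by
      refine splitRecurrence_monomials (one_le_orderBound _ _) (fun j n => L.step^[n] c j) s
        (fun m => p.coeff m) ((Finset.card_filter_le _ _).trans (hsize i).1)
        (fun m hm => (hsize i).2 m (Finset.mem_filter.1 hm).1) fun m hm j hj => ?_
      rw [hs, Finset.mem_filter] at hm
      have hij : i ≠ j := fun h => hj (h ▸ hm.2)
      have hdep : L.Dep i j := Relation.TransGen.single ⟨hij,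
        MvPolynomial.mem_vars_iff_mem_support j |>.2 ⟨m, hm.1, Finsupp.mem_support_iff.2 hj⟩⟩
      have hlt := depCount_lt hL.1 hdep
      exact (ih _ hlt j rfl).mono (orderBound_mono hB hlt)
    rw [orderBound_succ, add_comm]
    refine hrest.of_recurrence (p.coeff (Finsupp.single i 1)) fun n => ?_
    rw [step_iterate_succ_apply, MvPolynomial.eval_eq', ← hp,
      ← Finset.sum_filter_add_sum_filter_not p.support (fun m => m i = 0), add_comm]
    congr 1
    have hsub : p.support.filter (fun m => ¬ m i = 0) ⊆ {Finsupp.single i 1} := by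
      intro m hm
      rw [Finset.mem_filter] at hm
      have hdeg := hL.2 i m hm.1 hm.2
      rw [Finset.mem_singleton]
      have h1 := Finsupp.degree_eq_sum m
      have hsum := Finset.add_sum_erase Finset.univ m (Finset.mem_univ i)
      ext j
      by_cases hj : j = i
      · subst hj
        rw [Finsupp.single_eq_same]
        have := hm.2
        omega
      · rw [Finsupp.single_eq_of_ne hj]
        have := Finset.single_le_sum (f := m) (fun _ _ => Nat.zero_le _)
          (Finset.mem_erase.2 ⟨hj, Finset.mem_univ j⟩)
        have := hm.2
        omega
    rw [Finset.sum_subset hsub, Finset.sum_singleton]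
    · congr 1
      rw [Finset.prod_eq_single i]
      · simp
      · intro j _ hj
        rw [Finsupp.single_eq_of_ne hj, pow_zero]
      · simp
    · intro m hm hm'
      rw [Finset.mem_singleton] at hm
      subst hm
      rw [Finset.mem_filter, not_and] at hm'
      have : p.coeff (Finsupp.single i 1) = 0 := by
        by_contra h
        exact hm' (MvPolynomial.mem_support_iff.2 h) (by simp)
      rw [this, zero_mul]

theorem splitRecurrence_eval_orbit {L : PolyLoop d} (hL : L.IsTwn) {B : ℕ} (hB : 1 ≤ B)
    (hdB : d ≤ B) (hsize : ∀ i, SizeLE B (L.update i)) (c : Fin d → RealAlg)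
    {p : MvPolynomial (Fin d) RealAlg} (hp : SizeLE B p) :
    SplitRecurrence (B * orderBound B (B + 1) ^ B)
      (fun n => MvPolynomial.eval (L.step^[n] c) p) := by
  have := splitRecurrence_monomials (one_le_orderBound B (B + 1)) (fun j n => L.step^[n] c j)
    p.support (fun m => p.coeff m) hp.1 hp.2 fun m _ j _ =>
      (splitRecurrence_orbit hL hB hsize c j).mono
        (orderBound_mono hB (by have := L.depCount_le j; omega))
  simpa only [MvPolynomial.eval_eq'] using this

end PolyLoop

/-! ### The Gödel number of a code bounds the size of the coded object -/

section Encode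

variable {α : Type*} [Encodable α]

theorem encode_lt_of_mem {l : List α} {a : α} (h : a ∈ l) : encode a < encode l := by
  induction l with
  | nil => simp at h
  | cons b l ih =>
    rw [encode_list_cons]
    rcases List.mem_cons.1 h with rfl | h
    · exact Nat.lt_succ_of_le (Nat.left_le_pair _ _)
    · exact (ih h).trans (Nat.lt_succ_of_le (Nat.right_le_pair _ _))

theorem length_le_encode (l : List α) : l.length ≤ encode l := by
  induction l with
  | nil => simp
  | cons b l ih =>
    rw [encode_list_cons, List.length_cons]
    exact Nat.succ_le_succ (ih.trans (Nat.right_le_pair _ _))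

theorem sum_le_encode (l : List ℕ) : l.sum ≤ encode l := by
  induction l with
  | nil => simp
  | cons b l ih =>
    rw [encode_list_cons, List.sum_cons]
    exact (Nat.add_le_add_left ih b).trans ((Nat.add_le_pair _ _).trans (Nat.le_succ _))

end Encode

theorem PolyCode.Represents.sizeLE {κ R : Type} [CommSemiring R] [Encodable κ]
    {rep : κ → R → Prop} {n : ℕ}
    {w : PolyCode κ} {p : MvPolynomial (Fin n) R} (h : PolyCode.Represents rep w p) {B : ℕ}
    (hB : encode w ≤ B) : SizeLE B p := by
  classical
  have key : p.support.card ≤ w.length ∧ ∀ m ∈ p.support, ∃ x ∈ w, x.2 = List.ofFn m := by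
    clear hB
    induction h with
    | nil => simp
    | @cons u α w p m hu _ ih =>
      have hsub : (MvPolynomial.monomial m α + p).support ⊆ insert m p.support := by
        refine MvPolynomial.support_add.trans (Finset.union_subset ?_ (Finset.subset_insert _ _))
        exact MvPolynomial.support_monomial_subset.trans (by simp)
      refine ⟨(Finset.card_le_card hsub).trans ((Finset.card_insert_le _ _).trans ?_), ?_⟩
      · simpa using ih.1
      · intro m' hm'
        rcases Finset.mem_insert.1 (hsub hm') with rfl | hm'
        · exact ⟨_, List.mem_cons_self, rfl⟩
        · obtain ⟨x, hx, h⟩ := ih.2 m' hm'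
          exact ⟨x, List.mem_cons_of_mem _ hx, h⟩
  refine ⟨key.1.trans ((length_le_encode w).trans hB), fun m hm => ?_⟩
  obtain ⟨x, hx, hxm⟩ := key.2 m hm
  calc m.degree = (List.ofFn m).sum := by rw [Finsupp.degree_eq_sum, List.sum_ofFn]
    _ ≤ encode x.2 := hxm ▸ sum_le_encode _
    _ ≤ encode x := Nat.right_le_pair _ _
    _ ≤ B := (encode_lt_of_mem hx).le.trans hB

/-! ### Codes of formulas over indexed variables -/

/-- The truth value of a propositional formula under an arbitrary interpretation of its atoms, where
`atom true p` interprets `p > 0` and `atom false p` interprets `p ≥ 0`. -/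
def PropFormula.Interp {P : Type} (atom : Bool → P → Prop) : PropFormula P → Prop
  | .tt => True
  | .ff => False
  | .ge p => atom false p
  | .gt p => atom true p
  | .not φ => ¬ φ.Interp atom
  | .and φ ψ => φ.Interp atom ∧ ψ.Interp atom
  | .or φ ψ => φ.Interp atom ∨ ψ.Interp atom

theorem PropFormula.holds_iff_interp {P : Type} (v : P → RealAlg) (φ : PropFormula P) :
    φ.Holds v ↔ φ.Interp (fun b p => SignHolds b (v p)) := by
  induction φ with
  | tt => rfl
  | ff => rfl
  | ge p => rfl
  | gt p => rfl
  | not φ ih => exact not_congr ih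
  | and φ ψ ih₁ ih₂ => exact and_congr ih₁ ih₂
  | or φ ψ ih₁ ih₂ => exact or_congr ih₁ ih₂

/-- The polynomials that occur in a code of a propositional formula. -/
def atomPolys {κ : Type} (g : PropCode κ) : List (PolyCode κ) :=
  g.flatMap (Sum.elim (fun _ => []) (fun x => [x.2]))

theorem mem_atomPolys {κ : Type} {g : PropCode κ} {w : PolyCode κ} :
    w ∈ atomPolys g ↔ ∃ b, Sum.inr (b, w) ∈ g := by
  simp only [atomPolys, List.mem_flatMap]
  constructor
  · rintro ⟨x | x, hx, h⟩
    · simp at h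
    · simp only [Sum.elim_inr, List.mem_singleton] at h
      exact ⟨x.1, h ▸ hx⟩
  · rintro ⟨b, h⟩
    exact ⟨_, h, by simp⟩

theorem PropCode.Represents.exists_of_mem {κ R : Type} [CommSemiring R] {rep : κ → R → Prop}
    {n : ℕ} {g : PropCode κ} {φ : PropFormula (MvPolynomial (Fin n) R)}
    (h : PropCode.Represents rep g φ) {w : PolyCode κ} (hw : w ∈ atomPolys g) :
    ∃ p : MvPolynomial (Fin n) R, PolyCode.Represents rep w p := by
  obtain ⟨b, hb⟩ := mem_atomPolys.1 hw
  clear hw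
  induction h with
  | tt => simp at hb
  | ff => simp at hb
  | ge h => simp only [List.mem_singleton, Sum.inr.injEq, Prod.mk.injEq] at hb; exact ⟨_, hb.2 ▸ h⟩
  | gt h => simp only [List.mem_singleton, Sum.inr.injEq, Prod.mk.injEq] at hb; exact ⟨_, hb.2 ▸ h⟩
  | not _ ih => exact ih (by simpa using hb)
  | and _ _ ih₁ ih₂ | or _ _ ih₁ ih₂ =>
    simp only [List.mem_append, List.mem_singleton, reduceCtorEq, or_false] at hb
    exact hb.elim ih₁ ih₂

/-- If every atom of a formula eventually has a constant truth value, then so has the formula. -/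
theorem PropCode.Represents.eventually_interp {κ R : Type} [CommSemiring R] {rep : κ → R → Prop}
    {n : ℕ} {g : PropCode κ} {φ : PropFormula (MvPolynomial (Fin n) R)}
    (h : PropCode.Represents rep g φ) {s : ℕ → Bool → MvPolynomial (Fin n) R → Prop}
    {t : Bool → MvPolynomial (Fin n) R → Prop}
    (hst : ∀ w ∈ atomPolys g, ∀ p, PolyCode.Represents rep w p →
      ∀ b, ∀ᶠ k in atTop, (s k b p ↔ t b p)) :
    ∀ᶠ k in atTop, (φ.Interp (s k) ↔ φ.Interp t) := by
  have happ : ∀ u v : PropCode κ, atomPolys (u ++ v) = atomPolys u ++ atomPolys v :=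
    fun u v => by simp [atomPolys]
  induction h with
  | tt => exact Eventually.of_forall fun _ => Iff.rfl
  | ff => exact Eventually.of_forall fun _ => Iff.rfl
  | ge h => exact hst _ (by simp [atomPolys]) _ h _
  | gt h => exact hst _ (by simp [atomPolys]) _ h _
  | not _ ih =>
    filter_upwards [ih fun w hw => hst w (by simp [happ, hw])] with k hk using not_congr hk
  | and _ _ ih₁ ih₂ =>
    filter_upwards [ih₁ fun w hw => hst w (by simp [happ, hw]),
      ih₂ fun w hw => hst w (by simp [happ, hw])] with k h₁ h₂ using and_congr h₁ h₂
  | or _ _ ih₁ ih₂ =>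
    filter_upwards [ih₁ fun w hw => hst w (by simp [happ, hw]),
      ih₂ fun w hw => hst w (by simp [happ, hw])] with k h₁ h₂ using or_congr h₁ h₂

/-- A polynomial with rational coefficients in variables indexed by `ℕ`: a list of monomials, each a
coefficient with the list of its variables, repeated according to their exponents. -/
abbrev VarPoly : Type := List (RatCode × List ℕ)

/-- The rational number with the given code. -/
def RatCode.toRat (u : RatCode) : ℚ := (u.1 : ℚ) / ((u.2 : ℚ) + 1)

/-- The value of a polynomial at the given values of the variables. -/
noncomputable def VarPoly.val (V : ℕ → RealAlg) (P : VarPoly) : RealAlg :=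
  (P.map fun x => (x.1.toRat : RealAlg) * (x.2.map V).prod).sum

/-- All variables of the polynomial have an index below `n`. -/
def VarPoly.VarsLT (n : ℕ) (P : VarPoly) : Prop :=
  ∀ x ∈ P, ∀ i ∈ x.2, i < n

/-- The code with exponent vectors of length `n`. -/
def VarPoly.toCode (n : ℕ) (P : VarPoly) : PolyCode RatCode :=
  P.map fun x => (x.1, (List.range n).map fun i => (x.2.filter (fun j => j = i)).length)

@[simp]
theorem VarPoly.val_nil (V : ℕ → RealAlg) : VarPoly.val V [] = 0 := rfl

@[simp]
theorem VarPoly.val_cons (V : ℕ → RealAlg) (x : RatCode × List ℕ) (P : VarPoly) :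
    VarPoly.val V (x :: P) = (x.1.toRat : RealAlg) * (x.2.map V).prod + VarPoly.val V P := rfl

theorem VarPoly.val_append (V : ℕ → RealAlg) (P Q : VarPoly) :
    VarPoly.val V (P ++ Q) = VarPoly.val V P + VarPoly.val V Q := by
  simp [VarPoly.val]

theorem prod_map_eq_prod_pow {M : Type*} [CommMonoid M] (V : ℕ → M) {n : ℕ} {l : List ℕ}
    (hl : ∀ i ∈ l, i < n) :
    (l.map V).prod = ∏ i : Fin n, V i ^ (l.filter (fun j => j = (i : ℕ))).length := by
  induction l with
  | nil => simp
  | cons a l ih =>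
    rw [List.map_cons, List.prod_cons, ih fun i hi => hl i (List.mem_cons_of_mem _ hi)]
    have ha : a < n := hl a List.mem_cons_self
    rw [← Finset.mul_prod_erase _ _ (Finset.mem_univ (⟨a, ha⟩ : Fin n)),
      ← Finset.mul_prod_erase _ (fun i : Fin n =>
        V i ^ ((a :: l).filter (fun j => j = (i : ℕ))).length) (Finset.mem_univ (⟨a, ha⟩ : Fin n)),
      ← mul_assoc]
    congr 1
    · simp [pow_succ']
    · refine Finset.prod_congr rfl fun i hi => ?_
      rw [List.filter_cons_of_neg]
      simpa using fun h : a = i => (Finset.mem_erase.1 hi).1 (Fin.ext h.symm)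

theorem VarPoly.exists_represents {n : ℕ} {P : VarPoly} (hP : P.VarsLT n) :
    ∃ p : MvPolynomial (Fin n) ℚ, PolyCode.Represents RatCode.Represents (P.toCode n) p ∧
      ∀ V : ℕ → RealAlg, MvPolynomial.aeval (fun i : Fin n => V i) p = P.val V := by
  induction P with
  | nil => exact ⟨0, .nil, fun V => by simp⟩
  | cons x P ih =>
    obtain ⟨p, hp, hV⟩ := ih fun y hy => hP y (List.mem_cons_of_mem _ hy)
    set m : Fin n →₀ ℕ := Finsupp.equivFunOnFinite.symm fun i : Fin n =>
      (x.2.filter (fun j => j = (i : ℕ))).length with hm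
    have hcode : VarPoly.toCode n (x :: P) = (x.1, List.ofFn m) :: VarPoly.toCode n P := by
      have : (List.range n).map (fun i => (x.2.filter (fun j => j = i)).length) = List.ofFn m :=
        List.ext_getElem (by simp) fun i h₁ h₂ => by simp [hm]
      rw [← this]
      rfl
    refine ⟨MvPolynomial.monomial m x.1.toRat + p, hcode ▸ .cons m rfl hp, fun V => ?_⟩
    rw [map_add, hV, VarPoly.val_cons, MvPolynomial.aeval_monomial,
      prod_map_eq_prod_pow V (hP x List.mem_cons_self), Finsupp.prod_fintype _ _ (by simp)]
    rfl

/-- A code of a propositional formula over indexed variables. -/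
abbrev FormCode : Type := List (Fin 5 ⊕ Bool × VarPoly)

/-- The code of the formula over the polynomial ring with `n` variables. -/
def FormCode.toCode (n : ℕ) (c : FormCode) : PropCode RatCode :=
  c.map (Sum.elim Sum.inl fun x => Sum.inr (x.1, VarPoly.toCode n x.2))

/-- Among the values `V` of the variables that satisfy `A`, the formula with the code `c`, which has
its variables among the first `n` ones, defines the predicate `P`. -/
def FormCode.Means (n : ℕ) (A : (ℕ → RealAlg) → Prop) (c : FormCode) (P : (ℕ → RealAlg) → Prop) :
    Prop :=
  ∃ χ : PropFormula (MvPolynomial (Fin n) ℚ),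
    PropCode.Represents RatCode.Represents (FormCode.toCode n c) χ ∧
      ∀ V : ℕ → RealAlg, A V →
        (χ.Holds (fun p => MvPolynomial.aeval (fun i : Fin n => V i) p) ↔ P V)

namespace FormCode

variable {n : ℕ} {A : (ℕ → RealAlg) → Prop} {c c₁ c₂ : FormCode} {P P₁ P₂ : (ℕ → RealAlg) → Prop}

theorem toCode_append (n : ℕ) (c₁ c₂ : FormCode) :
    toCode n (c₁ ++ c₂) = toCode n c₁ ++ toCode n c₂ :=
  List.map_append

theorem Means.congr (h : Means n A c P₁) (hP : ∀ V, A V → (P₁ V ↔ P₂ V)) : Means n A c P₂ :=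
  let ⟨χ, hχ, hV⟩ := h
  ⟨χ, hχ, fun V hA => (hV V hA).trans (hP V hA)⟩

theorem means_tt : Means n A [Sum.inl 0] (fun _ => True) :=
  ⟨.tt, .tt, fun _ _ => Iff.rfl⟩

theorem means_ff : Means n A [Sum.inl 1] (fun _ => False) :=
  ⟨.ff, .ff, fun _ _ => Iff.rfl⟩

theorem means_atom (b : Bool) {Q : VarPoly} (hQ : Q.VarsLT n) :
    Means n A [Sum.inr (b, Q)] (fun V => SignHolds b (Q.val V)) := by
  obtain ⟨p, hp, hV⟩ := VarPoly.exists_represents hQ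
  cases b with
  | false => exact ⟨.ge p, .ge hp, fun V _ => by beta_reduce; rw [← hV]; rfl⟩
  | true => exact ⟨.gt p, .gt hp, fun V _ => by beta_reduce; rw [← hV]; rfl⟩

theorem Means.not (h : Means n A c P) : Means n A (c ++ [Sum.inl 2]) (fun V => ¬ P V) := by
  obtain ⟨χ, hχ, hV⟩ := h
  exact ⟨.not χ, by rw [toCode_append]; exact .not hχ, fun V hA => not_congr (hV V hA)⟩

theorem Means.and (h₁ : Means n A c₁ P₁) (h₂ : Means n A c₂ P₂) :
    Means n A (c₁ ++ c₂ ++ [Sum.inl 3]) (fun V => P₁ V ∧ P₂ V) := by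
  obtain ⟨χ₁, hχ₁, hV₁⟩ := h₁
  obtain ⟨χ₂, hχ₂, hV₂⟩ := h₂
  exact ⟨.and χ₁ χ₂, by rw [toCode_append, toCode_append]; exact .and hχ₁ hχ₂,
    fun V hA => and_congr (hV₁ V hA) (hV₂ V hA)⟩

theorem Means.or (h₁ : Means n A c₁ P₁) (h₂ : Means n A c₂ P₂) :
    Means n A (c₁ ++ c₂ ++ [Sum.inl 4]) (fun V => P₁ V ∨ P₂ V) := by
  obtain ⟨χ₁, hχ₁, hV₁⟩ := h₁
  obtain ⟨χ₂, hχ₂, hV₂⟩ := h₂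
  exact ⟨.or χ₁ χ₂, by rw [toCode_append, toCode_append]; exact .or hχ₁ hχ₂,
    fun V hA => or_congr (hV₁ V hA) (hV₂ V hA)⟩

/-- The second conjunct only matters where the first one holds. -/
theorem Means.and_of (h₁ : Means n (fun _ => True) c₁ P₁) (h₂ : Means n P₁ c₂ P₂) :
    Means n (fun _ => True) (c₁ ++ c₂ ++ [Sum.inl 3]) (fun V => P₁ V ∧ P₂ V) := by
  obtain ⟨χ₁, hχ₁, hV₁⟩ := h₁
  obtain ⟨χ₂, hχ₂, hV₂⟩ := h₂
  exact ⟨.and χ₁ χ₂, by rw [toCode_append, toCode_append]; exact .and hχ₁ hχ₂,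
    fun V hA => (and_congr_left' (hV₁ V hA)).trans (and_congr_right fun h => hV₂ V h)⟩

/-- The equation `Q = 0`, as `Q ≥ 0 ∧ ¬ Q > 0`. -/
def eqZero (Q : VarPoly) : FormCode :=
  [Sum.inr (false, Q), Sum.inr (true, Q), Sum.inl 2, Sum.inl 3]

theorem means_eqZero {Q : VarPoly} (hQ : Q.VarsLT n) :
    Means n A (eqZero Q) (fun V => Q.val V = 0) :=
  ((means_atom false hQ).and (means_atom true hQ).not).congr fun _ _ =>
    ⟨fun h => le_antisymm (not_lt.1 h.2) h.1, fun h => ⟨h.ge, h.not_gt⟩⟩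

/-- The conjunction of a list of formulas. -/
def conj (l : List FormCode) : FormCode :=
  [Sum.inl 0] ++ l.flatMap (· ++ [Sum.inl 3])

theorem means_conj_of_forall₂ {l : List FormCode} {Ps : List ((ℕ → RealAlg) → Prop)}
    (h : List.Forall₂ (Means n A) l Ps) : Means n A (conj l) (fun V => ∀ P ∈ Ps, P V) := by
  have key : ∀ (c : FormCode) (P₀ : (ℕ → RealAlg) → Prop), Means n A c P₀ →
      Means n A (c ++ l.flatMap (· ++ [Sum.inl 3])) (fun V => P₀ V ∧ ∀ P ∈ Ps, P V) := by
    induction h with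
    | nil => exact fun c P₀ hc => by simpa using hc
    | cons ha _ ih =>
      intro c P₀ hc
      have := ih _ _ (hc.and ha)
      rw [List.flatMap_cons]
      simp only [List.append_assoc] at this ⊢
      exact this.congr fun V _ => by rw [List.forall_mem_cons, and_assoc]
  exact (key _ _ means_tt).congr fun V _ => by rw [true_and]

theorem means_conj {ι : Type*} {l : List ι} {g : ι → FormCode} {P : ι → (ℕ → RealAlg) → Prop}
    (h : ∀ i ∈ l, Means n A (g i) (P i)) :
    Means n A (conj (l.map g)) (fun V => ∀ i ∈ l, P i V) := by
  have : List.Forall₂ (Means n A) (l.map g) (l.map P) := by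
    rw [List.forall₂_map_left_iff, List.forall₂_map_right_iff, List.forall₂_same]
    exact h
  exact (means_conj_of_forall₂ this).congr fun V _ => by simp

theorem means_conj_range {k : ℕ} {g : ℕ → FormCode} {P : ℕ → (ℕ → RealAlg) → Prop}
    (h : ∀ i < k, Means n A (g i) (P i)) :
    Means n A (conj ((List.range k).map g)) (fun V => ∀ i < k, P i V) := by
  simpa only [List.mem_range] using means_conj (l := List.range k) (g := g) (P := P)
    fun i hi => h i (List.mem_range.1 hi)

/-- Replace every atom of a formula by a formula. In postfix notation this acts on each symbol
separately. -/
def subst {κ : Type} (h : Bool × PolyCode κ → FormCode) (g : PropCode κ) : FormCode :=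
  g.flatMap (Sum.elim (fun k => [Sum.inl k]) h)

theorem means_subst {κ R : Type} [CommSemiring R] {rep : κ → R → Prop} {d : ℕ} {g : PropCode κ}
    {φ : PropFormula (MvPolynomial (Fin d) R)} (hg : PropCode.Represents rep g φ)
    {h : Bool × PolyCode κ → FormCode} {Q : Bool → MvPolynomial (Fin d) R → (ℕ → RealAlg) → Prop}
    (hQ : ∀ b, ∀ w ∈ atomPolys g, ∀ p, PolyCode.Represents rep w p →
      Means n A (h (b, w)) (Q b p)) :
    Means n A (subst h g) (fun V => φ.Interp (fun b p => Q b p V)) := by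
  have happ : ∀ u v : PropCode κ, atomPolys (u ++ v) = atomPolys u ++ atomPolys v :=
    fun u v => by simp [atomPolys]
  have hsub : ∀ u v : PropCode κ, subst h (u ++ v) = subst h u ++ subst h v :=
    fun u v => by simp [subst]
  have hatom : ∀ b w, subst h [Sum.inr (b, w)] = h (b, w) := fun b w => by simp [subst]
  induction hg with
  | tt => exact means_tt
  | ff => exact means_ff
  | ge h => rw [hatom]; exact hQ _ _ (by simp [atomPolys]) _ h
  | gt h => rw [hatom]; exact hQ _ _ (by simp [atomPolys]) _ h
  | not _ ih =>
    rw [hsub]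
    exact (ih fun b w hw => hQ b w (by simp [happ, hw])).not
  | and _ _ ih₁ ih₂ =>
    rw [hsub, hsub]
    exact (ih₁ fun b w hw => hQ b w (by simp [happ, hw])).and
      (ih₂ fun b w hw => hQ b w (by simp [happ, hw]))
  | or _ _ ih₁ ih₂ =>
    rw [hsub, hsub]
    exact (ih₁ fun b w hw => hQ b w (by simp [happ, hw])).or
      (ih₂ fun b w hw => hQ b w (by simp [happ, hw]))

end FormCode

/-! ### The closed formula that expresses non-termination -/

/-- The variable with index `a, b` in the block `tag`. -/
def blockVar (tag a b : ℕ) : ℕ := Nat.pair tag (Nat.pair a b)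

/-- The variable for the real algebraic number with code `α`. -/
def coefVar (α : AlgCode) : ℕ := blockVar 0 (@encode AlgCode Primcodable.toEncodable α) 0

/-- The `i`-th variable that is quantified over the real algebraic numbers in the given formula. -/
def algVar (i : ℕ) : ℕ := blockVar 1 i 0

/-- The variable for the `i`-th coordinate of the orbit after `t` steps. -/
def orbitVar (t i : ℕ) : ℕ := blockVar 2 t i

/-- The variable for the negative of the `j`-th characteristic root. -/
def rootVar (j : ℕ) : ℕ := blockVar 3 j 0

/-- The variables for the coordinates of the orbit after `t` steps. -/
def orbitVars (d t : ℕ) : List ℕ := (List.range d).map (orbitVar t)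

/-- The variables of the formula that defines the invariant set, in their order there; those that
range over the subring are `K, …, K + k - 1`. -/
def setVars (d k' k K : ℕ) : List ℕ :=
  (List.range k').map algVar ++ (List.range k).map (K + ·) ++ orbitVars d 0

/-- The product of the given variables with the given exponents, as a list of variables. -/
def powerVars (vars e : List ℕ) : List ℕ :=
  (List.range vars.length).flatMap fun j => (List.range (e.getD j 0)).map fun _ => vars.getD j 0

/-- The given polynomial at the given variables, with variables in place of its coefficients. -/
def translate (vars : List ℕ) (w : PolyCode AlgCode) : VarPoly :=
  w.map fun x => ((1, 0), coefVar x.1 :: powerVars vars x.2)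

/-- The expansion of `(E + m (j - 1)) ⋯ (E + m 0)`, as a list of terms, each a power of `E` with the
variables of its coefficient. -/
def shiftTerms (j : ℕ) : List (ℕ × List ℕ) :=
  Nat.rec [(0, [])] (fun i e => e.map (fun x => (x.1 + 1, x.2)) ++
    e.map fun x => (x.1, rootVar i :: x.2)) j

/-- The initial value of the `j`-th iterated difference of the values of the polynomial `w` on every
other point of the orbit, from the point `t` on. -/
def diffPoly (d t : ℕ) (w : PolyCode AlgCode) (j : ℕ) : VarPoly :=
  (shiftTerms j).flatMap fun e =>
    (translate (orbitVars d (2 * e.1 + t)) w).map fun x => (x.1, e.2 ++ x.2)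

/-- The formula for `LastSign` of the iterated differences. -/
def lastSignCode (d t : ℕ) (x : Bool × PolyCode AlgCode) (N : ℕ) : FormCode :=
  Nat.rec [Sum.inl (bif x.1 then 1 else 0)] (fun j c => [Sum.inr (true, diffPoly d t x.2 j)] ++
    ([Sum.inr (false, diffPoly d t x.2 j)] ++ c ++ [Sum.inl 3]) ++ [Sum.inl 4]) N

/-- The formula saying that the variable of the code `α` has the value that `α` represents. -/
def coefCode (α : AlgCode) : FormCode :=
  FormCode.conj [
    [Sum.inr (false, [((α.2.1, α.2.2.2), []), ((-1, 0), [coefVar α])]), Sum.inl 2],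
    [Sum.inr (true, [((α.2.2.1, α.2.2.2), []), ((-1, 0), [coefVar α])])],
    FormCode.eqZero ((List.range α.1.length).map fun i =>
      ((α.1.getD i 0, 0), (List.range i).map fun _ => coefVar α))]

/-- The codes of the coefficients of the polynomials in the list. -/
def coefs (l : List (PolyCode AlgCode)) : List AlgCode :=
  l.flatMap fun w => w.map Prod.fst

/-- The formula saying that the variables for the orbit are the first `T + 1` points of an orbit. -/
def orbitCode (a : List (PolyCode AlgCode)) (T : ℕ) : FormCode :=
  FormCode.conj ((List.range T).map fun t => FormCode.conj ((List.range a.length).map fun i =>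
    FormCode.eqZero (((-1, 0), [orbitVar (t + 1) i]) ::
      translate (orbitVars a.length t) (a.getD i []))))

/-- The formula saying that the characteristic roots are positive and increasing. -/
def rootCode (N : ℕ) : FormCode :=
  FormCode.conj [
    FormCode.conj ((List.range N).map fun j => [Sum.inr (true, [((-1, 0), [rootVar j])])]),
    FormCode.conj ((List.range (N - 1)).map fun j =>
      [Sum.inr (false, [((1, 0), [rootVar j]), ((-1, 0), [rootVar (j + 1)])])])]

/-- The formula saying that the sequences of the values of the polynomials in the list, on the even
and the odd points of the orbit, satisfy the recurrence with the guessed characteristic roots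
initially. The sequences start at the points `2 * N` and `2 * N + 1`, after `N` of their steps,
where the characteristic root zero has no influence any more. -/
def recurrenceCode (d N : ℕ) (l : List (PolyCode AlgCode)) : FormCode :=
  FormCode.conj (l.map fun w => FormCode.conj ((List.range (2 * N)).map fun i =>
    FormCode.eqZero (diffPoly d (2 * N + i) w N)))

/-- The formula saying that the loop condition eventually holds on every other point of the orbit,
from the point `t` on. -/
def guardCode (d N t : ℕ) (g : PropCode AlgCode) : FormCode :=
  FormCode.subst (fun x => lastSignCode d t x N) g

/-- The matrix of the defining formula of the invariant set, at the first point of the orbit. -/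
def setCode (vars : List ℕ) (g : PropCode AlgCode) : FormCode :=
  FormCode.subst (fun x => [Sum.inr (x.1, translate vars x.2)]) g

/-- The inputs of the reduction. -/
abbrev Input : Type := LoopCode × ExCode AlgCode

/-- A bound on all sizes in the input: its Gödel number. -/
def sizeBound (x : Input) : ℕ := @encode Input Primcodable.toEncodable x + 1

/-- The number of characteristic roots: they suffice for all atoms of the loop condition. -/
def rootCount (x : Input) : ℕ :=
  sizeBound x * (sizeBound x * orderBound (sizeBound x) (sizeBound x + 1) ^ sizeBound x)

/-- The number of variables of the output that range over all real algebraic numbers. As pairing is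
monotone, it exceeds every variable of the blocks `0, …, 3` whose indices are small enough. -/
def algCount (x : Input) : ℕ :=
  blockVar 4 (6 * rootCount x + 2 + sizeBound x) (6 * rootCount x + 2 + sizeBound x)

/-- The codes of all coefficients in the input. -/
def inputCoefs (x : Input) : List AlgCode :=
  coefs (x.1.1 ++ atomPolys x.1.2 ++ atomPolys x.2.2.2)

/-- The matrix of the output, over indexed variables. -/
def matrixCode (x : Input) : FormCode :=
  FormCode.conj ((inputCoefs x).map coefCode) ++
    FormCode.conj [
      setCode (setVars x.1.1.length x.2.1 x.2.2.1 (algCount x)) x.2.2.2,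
      orbitCode x.1.1 (6 * rootCount x + 1),
      rootCode (rootCount x),
      recurrenceCode x.1.1.length (rootCount x) (atomPolys x.1.2),
      FormCode.conj ((List.range 2).map fun r =>
        guardCode x.1.1.length (rootCount x) (2 * rootCount x + r) x.1.2)] ++ [Sum.inl 3]

/-- The reduction. -/
def nonterminationCode (x : Input) : ExCode RatCode :=
  (algCount x, x.2.2.1, FormCode.toCode (algCount x + x.2.2.1) (matrixCode x))

/-! ### The reduction is computable -/

section Computability

variable {α : Type*} [Primcodable α]

theorem primrec_pow : Primrec₂ ((· ^ ·) : ℕ → ℕ → ℕ) :=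
  Primrec₂.unpaired'.1 Nat.Primrec.pow

theorem primrec_blockVar {tag a b : α → ℕ} (ht : Primrec tag) (ha : Primrec a) (hb : Primrec b) :
    Primrec fun x => blockVar (tag x) (a x) (b x) :=
  Primrec₂.natPair.comp ht (Primrec₂.natPair.comp ha hb)

theorem primrec_coefVar : Primrec coefVar :=
  primrec_blockVar (.const 0) Primrec.encode (.const 0)

theorem primrec_algVar : Primrec algVar :=
  primrec_blockVar (.const 1) .id (.const 0)

theorem primrec_orbitVar : Primrec₂ orbitVar :=
  primrec_blockVar (.const 2) .fst .snd

theorem primrec_rootVar : Primrec rootVar :=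
  primrec_blockVar (.const 3) .id (.const 0)

theorem primrec_orbitVars : Primrec₂ orbitVars :=
  .list_map (Primrec.list_range.comp .fst) (primrec_orbitVar.comp (Primrec.snd.comp .fst) .snd)

theorem primrec_setVars {d k' k K : α → ℕ} (hd : Primrec d) (hk' : Primrec k') (hk : Primrec k)
    (hK : Primrec K) : Primrec fun x => setVars (d x) (k' x) (k x) (K x) :=
  Primrec.list_append.comp
    (Primrec.list_append.comp
      (.list_map (Primrec.list_range.comp hk') (primrec_algVar.comp .snd))
      (.list_map (Primrec.list_range.comp hk) (Primrec.nat_add.comp (hK.comp .fst) .snd)))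
    (primrec_orbitVars.comp hd (.const 0))

theorem primrec_powerVars : Primrec₂ powerVars :=
  .list_flatMap (Primrec.list_range.comp (Primrec.list_length.comp .fst))
    (.list_map
      (Primrec.list_range.comp ((Primrec.list_getD 0).comp (Primrec.snd.comp .fst) .snd))
      ((Primrec.list_getD 0).comp (Primrec.fst.comp (Primrec.fst.comp .fst))
        (Primrec.snd.comp .fst)))

theorem primrec_translate : Primrec₂ translate :=
  .list_map .snd (Primrec.pair (.const (1, 0)) (Primrec.list_cons.comp
    (primrec_coefVar.comp (Primrec.fst.comp .snd))
    (primrec_powerVars.comp (Primrec.fst.comp .fst) (Primrec.snd.comp .snd))))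

theorem primrec_shiftTerms : Primrec shiftTerms :=
  .nat_rec₁ _ (Primrec.list_append.comp
    (.list_map .snd
      (Primrec.pair (Primrec.succ.comp (Primrec.fst.comp .snd)) (Primrec.snd.comp .snd)))
    (.list_map .snd (Primrec.pair (Primrec.fst.comp .snd)
      (Primrec.list_cons.comp (primrec_rootVar.comp (Primrec.fst.comp .fst))
        (Primrec.snd.comp .snd)))))

theorem primrec_diffPoly {d t j : α → ℕ} {w : α → PolyCode AlgCode} (hd : Primrec d)
    (ht : Primrec t) (hw : Primrec w) (hj : Primrec j) :
    Primrec fun x => diffPoly (d x) (t x) (w x) (j x) :=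
  .list_flatMap (primrec_shiftTerms.comp hj)
    (.list_map
      (primrec_translate.comp
        (primrec_orbitVars.comp (hd.comp .fst) (Primrec.nat_add.comp
          (Primrec.nat_mul.comp (.const 2) (Primrec.fst.comp .snd)) (ht.comp .fst)))
        (hw.comp .fst))
      (Primrec.pair (Primrec.fst.comp .snd) (Primrec.list_append.comp
        (Primrec.snd.comp (Primrec.snd.comp .fst)) (Primrec.snd.comp .snd))))

theorem primrec_singleton {β : Type*} [Primcodable β] {f : α → β} (hf : Primrec f) :
    Primrec fun x => [f x] :=
  Primrec.list_cons.comp hf (.const [])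

theorem primrec_atom {b : α → Bool} {P : α → VarPoly} (hb : Primrec b) (hP : Primrec P) :
    Primrec fun x => (Sum.inr (b x, P x) : Fin 5 ⊕ Bool × VarPoly) :=
  Primrec.sumInr.comp (Primrec.pair hb hP)

theorem primrec_eqZero : Primrec FormCode.eqZero :=
  Primrec.list_cons.comp (primrec_atom (.const _) .id) (Primrec.list_cons.comp
    (primrec_atom (.const _) .id) (.const _))

theorem primrec_conj : Primrec FormCode.conj :=
  Primrec.list_append.comp (.const _) (.list_flatMap .id
    (Primrec.list_append.comp .snd (.const _)))

theorem primrec_subst {β : Type} [Primcodable β] {h : α → Bool × PolyCode β → FormCode}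
    {g : α → PropCode β} (hh : Primrec₂ h) (hg : Primrec g) :
    Primrec fun x => FormCode.subst (h x) (g x) :=
  .list_flatMap hg (Primrec.of_eq
    (Primrec.sumCasesOn (f := fun x : α × (Fin 5 ⊕ Bool × PolyCode β) => x.2) .snd
      (primrec_singleton (Primrec.sumInl.comp .snd)).to₂
      (hh.comp (Primrec.fst.comp .fst) .snd).to₂)
    fun x => by rcases x with ⟨x, y | y⟩ <;> rfl)

theorem primrec_lastSignCode {d t N : α → ℕ} {y : α → Bool × PolyCode AlgCode} (hd : Primrec d)
    (ht : Primrec t) (hy : Primrec y) (hN : Primrec N) :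
    Primrec fun x => lastSignCode (d x) (t x) (y x) (N x) := by
  have hdiff : Primrec fun x : α × ℕ × FormCode => diffPoly (d x.1) (t x.1) (y x.1).2 x.2.1 :=
    primrec_diffPoly (hd.comp .fst) (ht.comp .fst) (Primrec.snd.comp (hy.comp .fst))
      (Primrec.fst.comp .snd)
  exact .nat_rec' hN
    (primrec_singleton (Primrec.sumInl.comp ((Primrec.dom_bool fun b =>
      bif b then (1 : Fin 5) else 0).comp (Primrec.fst.comp hy))))
    (Primrec.list_append.comp (Primrec.list_append.comp
      (primrec_singleton (primrec_atom (.const _) hdiff))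
      (Primrec.list_append.comp (Primrec.list_append.comp
        (primrec_singleton (primrec_atom (.const _) hdiff)) (Primrec.snd.comp .snd)) (.const _)))
      (.const _)).to₂

theorem primrec_coefCode : Primrec coefCode := by
  have hz : Primrec fun α : AlgCode => ([((-1, 0), [coefVar α])] : VarPoly) :=
    primrec_singleton (Primrec.pair (.const _) (primrec_singleton primrec_coefVar))
  have hden : Primrec fun α : AlgCode => α.2.2.2 := Primrec.snd.comp (Primrec.snd.comp .snd)
  have h₁ : Primrec fun α : AlgCode => (((α.2.1, α.2.2.2), []) : RatCode × List ℕ) :=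
    Primrec.pair (Primrec.pair (Primrec.fst.comp .snd) hden) (.const _)
  have h₂ : Primrec fun α : AlgCode => (((α.2.2.1, α.2.2.2), []) : RatCode × List ℕ) :=
    Primrec.pair (Primrec.pair (Primrec.fst.comp (Primrec.snd.comp .snd)) hden) (.const _)
  refine primrec_conj.comp (Primrec.list_cons.comp ?_ (Primrec.list_cons.comp ?_
    (Primrec.list_cons.comp (primrec_eqZero.comp (.list_map
      (Primrec.list_range.comp (Primrec.list_length.comp .fst)) (Primrec.pair ?_ ?_))) (.const _))))
  · exact Primrec.list_cons.comp (primrec_atom (.const _) (Primrec.list_cons.comp h₁ hz)) (.const _)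
  · exact primrec_singleton (primrec_atom (.const _) (Primrec.list_cons.comp h₂ hz))
  · exact Primrec.pair ((Primrec.list_getD 0).comp (Primrec.fst.comp .fst) .snd) (.const _)
  · exact .list_map (Primrec.list_range.comp .snd)
      (primrec_coefVar.comp (Primrec.fst.comp .fst))

theorem primrec_coefs : Primrec coefs :=
  .list_flatMap .id (.list_map .snd (Primrec.fst.comp .snd))

theorem primrec_atomPolys {β : Type} [Primcodable β] : Primrec (atomPolys (κ := β)) :=
  .list_flatMap .id (Primrec.of_eq
    (Primrec.sumCasesOn (f := fun x : PropCode β × (Fin 5 ⊕ Bool × PolyCode β) => x.2) .snd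
      (Primrec.const ([] : List (PolyCode β))).to₂
      (primrec_singleton (Primrec.snd.comp .snd)).to₂)
    fun x => by rcases x with ⟨x, y | y⟩ <;> rfl)

theorem primrec_orbitCode : Primrec₂ orbitCode := by
  refine primrec_conj.comp (.list_map (Primrec.list_range.comp .snd) (primrec_conj.comp
    (.list_map (Primrec.list_range.comp (Primrec.list_length.comp (Primrec.fst.comp .fst)))
      (primrec_eqZero.comp (Primrec.list_cons.comp (Primrec.pair (.const _) (primrec_singleton
        (primrec_orbitVar.comp (Primrec.succ.comp (Primrec.snd.comp .fst)) .snd)))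
        (primrec_translate.comp ?_ ?_))))))
  · exact primrec_orbitVars.comp
      (Primrec.list_length.comp (Primrec.fst.comp (Primrec.fst.comp .fst))) (Primrec.snd.comp .fst)
  · exact (Primrec.list_getD []).comp (Primrec.fst.comp (Primrec.fst.comp .fst)) .snd

theorem primrec_rootCode : Primrec rootCode := by
  refine primrec_conj.comp (Primrec.list_cons.comp (primrec_conj.comp (.list_map .list_range ?_))
    (Primrec.list_cons.comp (primrec_conj.comp (.list_map
      (Primrec.list_range.comp (Primrec.nat_sub.comp .id (.const 1))) ?_)) (.const _)))
  · exact primrec_singleton (primrec_atom (.const _) (primrec_singleton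
      (Primrec.pair (.const _) (primrec_singleton (primrec_rootVar.comp .snd)))))
  · exact primrec_singleton (primrec_atom (.const _) (Primrec.list_cons.comp
      (Primrec.pair (.const _) (primrec_singleton (primrec_rootVar.comp .snd)))
      (primrec_singleton (Primrec.pair (.const _)
        (primrec_singleton (primrec_rootVar.comp (Primrec.succ.comp .snd)))))))

theorem primrec_recurrenceCode {d N : α → ℕ} {l : α → List (PolyCode AlgCode)} (hd : Primrec d)
    (hN : Primrec N) (hl : Primrec l) : Primrec fun x => recurrenceCode (d x) (N x) (l x) := by
  have h2 : Primrec fun x => 2 * N x := Primrec.nat_mul.comp (.const 2) hN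
  refine primrec_conj.comp (.list_map hl (primrec_conj.comp (.list_map
    (Primrec.list_range.comp (h2.comp .fst)) (primrec_eqZero.comp (primrec_diffPoly ?_ ?_ ?_ ?_)))))
  · exact hd.comp (Primrec.fst.comp .fst)
  · exact Primrec.nat_add.comp (h2.comp (Primrec.fst.comp .fst)) .snd
  · exact Primrec.snd.comp .fst
  · exact hN.comp (Primrec.fst.comp .fst)

theorem primrec_guardCode {d N t : α → ℕ} {g : α → PropCode AlgCode} (hd : Primrec d)
    (hN : Primrec N) (ht : Primrec t) (hg : Primrec g) :
    Primrec fun x => guardCode (d x) (N x) (t x) (g x) :=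
  primrec_subst (primrec_lastSignCode (hd.comp .fst) (ht.comp .fst) .snd (hN.comp .fst)) hg

theorem primrec_setCode : Primrec₂ setCode :=
  primrec_subst (primrec_singleton (primrec_atom (Primrec.fst.comp .snd)
    (primrec_translate.comp (Primrec.fst.comp .fst) (Primrec.snd.comp .snd)))) .snd

theorem primrec_orderBound : Primrec₂ orderBound :=
  .nat_rec' .snd (.const 1) (Primrec.nat_add.comp (.const 1) (Primrec.nat_mul.comp
    (Primrec.fst.comp .fst) (primrec_pow.comp (Primrec.snd.comp .snd) (Primrec.fst.comp .fst)))).to₂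

theorem primrec_sizeBound : Primrec sizeBound :=
  Primrec.succ.comp Primrec.encode

theorem primrec_rootCount : Primrec rootCount :=
  Primrec.nat_mul.comp primrec_sizeBound (Primrec.nat_mul.comp primrec_sizeBound (primrec_pow.comp
    (primrec_orderBound.comp primrec_sizeBound (Primrec.succ.comp primrec_sizeBound))
    primrec_sizeBound))

theorem primrec_algCount : Primrec algCount := by
  have : Primrec fun x => 6 * rootCount x + 2 + sizeBound x :=
    Primrec.nat_add.comp (Primrec.nat_add.comp (Primrec.nat_mul.comp (.const 6) primrec_rootCount)
      (.const 2)) primrec_sizeBound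
  exact primrec_blockVar (.const 4) this this

theorem primrec_inputCoefs : Primrec inputCoefs :=
  primrec_coefs.comp (Primrec.list_append.comp (Primrec.list_append.comp (Primrec.fst.comp .fst)
    (primrec_atomPolys.comp (Primrec.snd.comp .fst)))
    (primrec_atomPolys.comp (Primrec.snd.comp (Primrec.snd.comp .snd))))

theorem primrec_matrixCode : Primrec matrixCode := by
  have ha : Primrec fun x : Input => x.1.1 := Primrec.fst.comp .fst
  have hd : Primrec fun x : Input => x.1.1.length := Primrec.list_length.comp ha
  have hg : Primrec fun x : Input => x.1.2 := Primrec.snd.comp .fst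
  have h2 : Primrec fun x => 2 * rootCount x := Primrec.nat_mul.comp (.const 2) primrec_rootCount
  refine Primrec.list_append.comp (Primrec.list_append.comp
    (primrec_conj.comp (.list_map primrec_inputCoefs (primrec_coefCode.comp .snd).to₂))
    (primrec_conj.comp (Primrec.list_cons.comp ?_ (Primrec.list_cons.comp ?_
      (Primrec.list_cons.comp (primrec_rootCode.comp primrec_rootCount)
        (Primrec.list_cons.comp ?_ (Primrec.list_cons.comp (primrec_conj.comp
          (.list_map (.const _) ?_)) (.const _)))))))) (.const _)
  · exact primrec_setCode.comp (primrec_setVars hd (Primrec.fst.comp .snd)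
      (Primrec.fst.comp (Primrec.snd.comp .snd)) primrec_algCount)
      (Primrec.snd.comp (Primrec.snd.comp .snd))
  · exact primrec_orbitCode.comp ha (Primrec.succ.comp
      (Primrec.nat_mul.comp (.const 6) primrec_rootCount))
  · exact primrec_recurrenceCode hd primrec_rootCount (primrec_atomPolys.comp hg)
  · exact primrec_guardCode (hd.comp .fst) (primrec_rootCount.comp .fst)
      (Primrec.nat_add.comp (h2.comp .fst) .snd) (hg.comp .fst)

theorem primrec_varPoly_toCode : Primrec₂ VarPoly.toCode := by
  have hcount : Primrec₂ fun (l : List ℕ) (i : ℕ) => (l.filter (fun j => j = i)).length :=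
    Primrec.list_length.comp (PrimrecRel.listFilter Primrec.eq)
  exact .list_map .snd (Primrec.pair (Primrec.fst.comp .snd) (.list_map
    (Primrec.list_range.comp (Primrec.fst.comp .fst))
    (hcount.comp (Primrec.snd.comp (Primrec.snd.comp .fst)) .snd)))

theorem primrec_formCode_toCode : Primrec₂ FormCode.toCode :=
  .list_map .snd (Primrec.of_eq
    (Primrec.sumCasesOn (f := fun x : (ℕ × FormCode) × (Fin 5 ⊕ Bool × VarPoly) => x.2) .snd
      (Primrec.sumInl.comp .snd : Primrec _).to₂
      (Primrec.sumInr.comp (Primrec.pair (Primrec.fst.comp .snd) (primrec_varPoly_toCode.comp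
        (Primrec.fst.comp (Primrec.fst.comp .fst)) (Primrec.snd.comp .snd))) : Primrec _).to₂)
    fun x => by rcases x with ⟨x, y | y⟩ <;> rfl)

theorem primrec_nonterminationCode : Primrec nonterminationCode := by
  have hk : Primrec fun x : Input => x.2.2.1 := Primrec.fst.comp (Primrec.snd.comp .snd)
  exact Primrec.pair primrec_algCount (Primrec.pair hk (primrec_formCode_toCode.comp
    (Primrec.nat_add.comp primrec_algCount hk) primrec_matrixCode))

end Computability

-- Below only the size of these numbers matters, and unfolding them makes unification expensive.
attribute [irreducible] rootCount algCount

/-! ### The meaning of the output -/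

theorem AlgCode.Represents.unique {u : AlgCode} {α β : RealAlg} (hα : u.Represents α)
    (hβ : u.Represents β) : α = β :=
  Subtype.ext ((hβ α).1 ((hα α).2 rfl))

@[simp]
theorem RatCode.toRat_int (a : ℤ) : RatCode.toRat (a, 0) = a := by simp [RatCode.toRat]

@[simp]
theorem length_orbitVars (d t : ℕ) : (orbitVars d t).length = d := by simp [orbitVars]

theorem orbitVars_getD (d t : ℕ) (i : Fin d) : (orbitVars d t).getD i 0 = orbitVar t i := by
  simp [orbitVars, List.getD_eq_getElem?_getD]

theorem prod_flatMap_range {M : Type*} [CommMonoid M] (V : ℕ → M) (f : ℕ → List ℕ) (n : ℕ) :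
    (((List.range n).flatMap f).map V).prod = ∏ j ∈ Finset.range n, ((f j).map V).prod := by
  induction n with
  | zero => simp
  | succ n ih => simp [List.range_succ, Finset.prod_range_succ, ih]

theorem prod_powerVars {n : ℕ} {vars : List ℕ} (hvars : vars.length = n) (V : ℕ → RealAlg)
    (m : Fin n →₀ ℕ) :
    ((powerVars vars (List.ofFn m)).map V).prod = ∏ i : Fin n, V (vars.getD i 0) ^ m i := by
  subst hvars
  rw [powerVars, prod_flatMap_range, Finset.prod_range]
  refine Finset.prod_congr rfl fun i _ => ?_
  rw [List.map_map, Function.comp_def, List.map_const', List.prod_replicate, List.length_range]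
  congr 1
  simp [List.getD_eq_getElem?_getD]

theorem val_translate {n : ℕ} {w : PolyCode AlgCode} {p : MvPolynomial (Fin n) RealAlg}
    (h : PolyCode.Represents AlgCode.Represents w p) {vars : List ℕ} (hvars : vars.length = n)
    {V : ℕ → RealAlg} (hV : ∀ α ∈ w.map Prod.fst, AlgCode.Represents α (V (coefVar α))) :
    (translate vars w).val V = MvPolynomial.eval (fun i : Fin n => V (vars.getD i 0)) p := by
  induction h with
  | nil => simp [translate]
  | @cons u α w p m hu _ ih =>
    rw [List.map_cons, List.forall_mem_cons] at hV
    have ih := ih hV.2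
    rw [translate] at ih
    rw [translate, List.map_cons, VarPoly.val_cons, ih, map_add, MvPolynomial.eval_monomial,
      List.map_cons, List.prod_cons, hV.1.unique hu, prod_powerVars hvars,
      Finsupp.prod_fintype _ _ (by simp)]
    simp

theorem mem_powerVars {vars e : List ℕ} {v : ℕ} (hv : v ∈ powerVars vars e) : v ∈ vars := by
  simp only [powerVars, List.mem_flatMap, List.mem_range, List.mem_map] at hv
  obtain ⟨j, hj, _, _, rfl⟩ := hv
  rw [List.getD_eq_getElem _ _ hj]
  exact List.getElem_mem hj

theorem varsLT_translate {n : ℕ} {vars : List ℕ} {w : PolyCode AlgCode}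
    (hvars : ∀ v ∈ vars, v < n) (hw : ∀ α ∈ w.map Prod.fst, coefVar α < n) :
    (translate vars w).VarsLT n := by
  intro x hx v hv
  obtain ⟨y, hy, rfl⟩ := List.mem_map.1 hx
  rcases List.mem_cons.1 hv with rfl | hv
  · exact hw _ (List.mem_map_of_mem hy)
  · exact hvars v (mem_powerVars hv)

theorem shiftTerms_succ (j : ℕ) : shiftTerms (j + 1) =
    (shiftTerms j).map (fun x => (x.1 + 1, x.2)) ++
      (shiftTerms j).map fun x => (x.1, rootVar j :: x.2) := rfl

theorem iterDiff_eq_sum_shiftTerms (V u : ℕ → RealAlg) (j n : ℕ) :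
    iterDiff (fun i => V (rootVar i)) j u n =
      ((shiftTerms j).map fun e => (e.2.map V).prod * u (n + e.1)).sum := by
  induction j generalizing n with
  | zero => simp [shiftTerms, iterDiff]
  | succ j ih =>
    rw [iterDiff, ih, ih, shiftTerms_succ, List.map_append, List.sum_append, List.map_map,
      List.map_map, ← List.sum_map_mul_left]
    congr 2
    · simp only [Function.comp_def]
      exact List.map_congr_left fun e _ => by rw [add_right_comm, add_assoc]
    · simp only [Function.comp_def, List.map_cons, List.prod_cons, mul_assoc]

theorem mem_shiftTerms {j : ℕ} {e : ℕ × List ℕ} (he : e ∈ shiftTerms j) :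
    e.1 ≤ j ∧ ∀ v ∈ e.2, ∃ i < j, v = rootVar i := by
  induction j generalizing e with
  | zero =>
    obtain rfl : e = (0, []) := List.mem_singleton.1 he
    simp
  | succ j ih =>
    rw [shiftTerms_succ, List.mem_append, List.mem_map, List.mem_map] at he
    rcases he with ⟨x, hx, rfl⟩ | ⟨x, hx, rfl⟩
    · refine ⟨Nat.succ_le_succ (ih hx).1, fun v hv => ?_⟩
      obtain ⟨i, hi, h⟩ := (ih hx).2 v hv
      exact ⟨i, by omega, h⟩
    · refine ⟨(ih hx).1.trans (Nat.le_succ j), fun v hv => ?_⟩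
      rcases List.mem_cons.1 hv with rfl | hv
      · exact ⟨j, by omega, rfl⟩
      · obtain ⟨i, hi, h⟩ := (ih hx).2 v hv
        exact ⟨i, by omega, h⟩

theorem val_diffPoly (V : ℕ → RealAlg) (d t : ℕ) (w : PolyCode AlgCode) (j : ℕ) :
    (diffPoly d t w j).val V = iterDiff (fun i => V (rootVar i)) j
      (fun l => (translate (orbitVars d (2 * l + t)) w).val V) 0 := by
  have hmul : ∀ (vs : List ℕ) (P : VarPoly),
      VarPoly.val V (P.map fun x => (x.1, vs ++ x.2)) = (vs.map V).prod * P.val V := by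
    intro vs P
    induction P with
    | nil => simp
    | cons x P ih =>
      rw [List.map_cons, VarPoly.val_cons, VarPoly.val_cons, ih, List.map_append, List.prod_append]
      ring
  rw [iterDiff_eq_sum_shiftTerms, diffPoly]
  induction shiftTerms j with
  | nil => simp
  | cons e es ih =>
    rw [List.flatMap_cons, VarPoly.val_append, ih, hmul, List.map_cons, List.sum_cons, zero_add]

theorem varsLT_diffPoly {n d t j : ℕ} {w : PolyCode AlgCode}
    (horb : ∀ s ≤ 2 * j + t, ∀ i < d, orbitVar s i < n) (hroot : ∀ i < j, rootVar i < n)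
    (hw : ∀ α ∈ w.map Prod.fst, coefVar α < n) : (diffPoly d t w j).VarsLT n := by
  intro x hx v hv
  obtain ⟨e, he, hx⟩ := List.mem_flatMap.1 hx
  obtain ⟨y, hy, rfl⟩ := List.mem_map.1 hx
  rcases List.mem_append.1 hv with hv | hv
  · obtain ⟨i, hi, rfl⟩ := (mem_shiftTerms he).2 v hv
    exact hroot i hi
  · refine varsLT_translate (fun v hv => ?_) hw y hy v hv
    obtain ⟨i, hi, rfl⟩ := List.mem_map.1 hv
    exact horb _ (by have := (mem_shiftTerms he).1; omega) i (List.mem_range.1 hi)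

section Means

open FormCode

variable {n : ℕ} {A : (ℕ → RealAlg) → Prop}

theorem means_lastSignCode {d t N : ℕ} {w : PolyCode AlgCode} (b : Bool)
    (hw : ∀ j < N, (diffPoly d t w j).VarsLT n) :
    Means n A (lastSignCode d t (b, w) N)
      (fun V => LastSign b (fun j => (diffPoly d t w j).val V) N) := by
  induction N with
  | zero =>
    cases b with
    | false => exact means_tt.congr fun V _ => by simp [LastSign, SignHolds]
    | true => exact means_ff.congr fun V _ => by simp [LastSign, SignHolds]
  | succ N ih =>
    exact (means_atom true (hw N (by omega))).or ((means_atom false (hw N (by omega))).and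
      (ih fun j hj => hw j (by omega)))

theorem val_evalList (V : ℕ → RealAlg) (v : ℕ) (l : List ℤ) :
    ((VarPoly.val V ((List.range l.length).map fun i =>
      ((l.getD i 0, 0), (List.range i).map fun _ => v)) : RealAlg) : ℝ) =
      evalIntList l (V v : ℝ) := by
  have h : VarPoly.val V ((List.range l.length).map fun i =>
      ((l.getD i 0, 0), (List.range i).map fun _ => v)) =
      ∑ i ∈ Finset.range l.length, (l.getD i 0 : RealAlg) * V v ^ i := by
    rw [Finset.sum_range]
    simp only [VarPoly.val, List.map_map, Function.comp_def, RatCode.toRat_int, List.map_const',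
      List.length_range, Rat.cast_intCast]
    rw [← List.sum_ofFn]
    congr 1
    refine List.ext_getElem (by simp) fun i h₁ h₂ => ?_
    have hi : i < l.length := by simpa using h₁
    simp [hi]
  rw [h]
  clear h
  induction l with
  | nil => simp [evalIntList]
  | cons a l ih =>
    rw [evalIntList, List.foldr_cons, ← evalIntList, ← ih, List.length_cons,
      Finset.sum_range_succ']
    push_cast
    rw [Finset.mul_sum]
    simp only [pow_succ, List.getD_cons_succ, List.getD_cons_zero, mul_one, pow_zero]
    rw [add_comm]
    exact congrArg _ (Finset.sum_congr rfl fun i _ => by ring)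

/-- If `α` represents some number, the interval and the polynomial single out that number. -/
theorem means_coefCode {α : AlgCode} (hα : ∃ a, α.Represents a) (hn : coefVar α < n) :
    Means n A (coefCode α) (fun V => α.Represents (V (coefVar α))) := by
  have hlin : ∀ u : RatCode, VarPoly.VarsLT n [(u, []), ((-1, 0), [coefVar α])] := by
    intro u x hx i hi
    simp only [List.mem_cons, List.not_mem_nil, or_false] at hx
    rcases hx with rfl | rfl
    · simp at hi
    · rw [List.mem_singleton.1 hi]
      exact hn
  have hpoly : VarPoly.VarsLT n ((List.range α.1.length).map fun i =>
      ((α.1.getD i 0, 0), (List.range i).map fun _ => coefVar α)) := by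
    intro x hx i hi
    obtain ⟨j, _, rfl⟩ := List.mem_map.1 hx
    obtain ⟨_, _, rfl⟩ := List.mem_map.1 hi
    exact hn
  have hval : ∀ (u : RatCode) (V : ℕ → RealAlg),
      ((VarPoly.val V [(u, []), ((-1, 0), [coefVar α])] : RealAlg) : ℝ) =
        (u.1 : ℝ) / ((u.2 : ℝ) + 1) - V (coefVar α) := by
    intro u V
    simp [RatCode.toRat, sub_eq_add_neg]
  refine (means_conj_of_forall₂ (.cons (means_atom false (hlin _)).not (.cons
    (means_atom true (hlin _)) (.cons (means_eqZero hpoly) .nil)))).congr fun V _ => ?_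
  simp only [List.forall_mem_cons, List.not_mem_nil, false_imp_iff, implies_true, and_true]
  obtain ⟨a, ha⟩ := hα
  have hiff : α.Represents (V (coefVar α)) ↔ ((V (coefVar α) : ℝ) = (a : ℝ)) :=
    ⟨fun h => congrArg _ (h.unique ha), fun h => (Subtype.ext h : V (coefVar α) = a) ▸ ha⟩
  rw [hiff, ← ha (V (coefVar α)), ← val_evalList]
  refine and_congr ?_ (and_congr ?_ ?_)
  · change ¬ (0 : ℝ) ≤ _ ↔ _
    rw [hval, not_le, sub_neg]
  · change (0 : ℝ) < _ ↔ _
    rw [hval, sub_pos]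
  · exact Subtype.ext_iff

end Means

/-! ### The variables of the output -/

theorem blockVar_lt {tag a b tag' M : ℕ} (ht : tag < tag') (ha : a ≤ M) (hb : b ≤ M) :
    blockVar tag a b < blockVar tag' M M := by
  have hmono : ∀ {a b a' b' : ℕ}, a ≤ a' → b ≤ b' → Nat.pair a b ≤ Nat.pair a' b' := by
    intro a b a' b' h h'
    rcases h.lt_or_eq with h | rfl <;> rcases h'.lt_or_eq with h' | rfl
    · exact ((Nat.pair_lt_pair_left _ h).trans (Nat.pair_lt_pair_right _ h')).le
    · exact (Nat.pair_lt_pair_left _ h).le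
    · exact (Nat.pair_lt_pair_right _ h').le
    · exact le_rfl
  exact (Nat.pair_lt_pair_left _ ht).trans_le (hmono le_rfl (hmono ha hb))

theorem setVars_getD {d k' k K : ℕ} (V : ℕ → RealAlg) :
    (fun i : Fin (k' + k + d) => V ((setVars d k' k K).getD i 0)) =
      Fin.append (Fin.append (fun i : Fin k' => V (algVar i)) (fun i : Fin k => V (K + i)))
        (fun i : Fin d => V (orbitVar 0 i)) := by
  funext i
  refine Fin.addCases (fun i => ?_) (fun i => ?_) i
  · refine Fin.addCases (fun i => ?_) (fun i => ?_) i
    · simp [setVars, orbitVars, List.getD_eq_getElem?_getD, List.getElem?_append]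
    · simp [setVars, orbitVars, List.getD_eq_getElem?_getD, List.getElem?_append]
  · have h₁ : ¬ k' + k + (i : ℕ) < k' := by omega
    have h₂ : ¬ k' + k + (i : ℕ) - k' < k := by omega
    have h₃ : k' + k + (i : ℕ) - k' - k = i := by omega
    simp [setVars, orbitVars, List.getD_eq_getElem?_getD, List.getElem?_append, h₁, h₂, h₃]

section Sizes

variable (x : Input)

theorem length_le_sizeBound : x.1.1.length ≤ sizeBound x := by
  refine (length_le_encode x.1.1).trans ?_
  exact (Nat.left_le_pair _ _).trans ((Nat.left_le_pair _ _).trans (Nat.le_succ _))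

theorem algVars_le_sizeBound : x.2.1 ≤ sizeBound x :=
  (Nat.left_le_pair _ _).trans ((Nat.right_le_pair _ _).trans (Nat.le_succ _))

theorem length_guard_le_sizeBound : x.1.2.length ≤ sizeBound x := by
  refine (length_le_encode x.1.2).trans ?_
  exact (Nat.right_le_pair _ _).trans ((Nat.left_le_pair _ _).trans (Nat.le_succ _))

theorem encode_update_le_sizeBound {w : PolyCode AlgCode} (hw : w ∈ x.1.1) :
    @encode (PolyCode AlgCode) Primcodable.toEncodable w ≤ sizeBound x := by
  refine (encode_lt_of_mem hw).le.trans ?_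
  exact (Nat.left_le_pair _ _).trans ((Nat.left_le_pair _ _).trans (Nat.le_succ _))

theorem encode_le_of_mem_atomPolys {w : PolyCode AlgCode} {g : PropCode AlgCode}
    (hw : w ∈ atomPolys g) : @encode (PolyCode AlgCode) Primcodable.toEncodable w ≤
      @encode (PropCode AlgCode) Primcodable.toEncodable g := by
  obtain ⟨b, hb⟩ := mem_atomPolys.1 hw
  refine le_trans ?_ (encode_lt_of_mem hb).le
  have h : @encode (PolyCode AlgCode) Primcodable.toEncodable w ≤
    @encode (Bool × PolyCode AlgCode) Primcodable.toEncodable (b, w) := Nat.right_le_pair _ _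
  refine h.trans ?_
  change _ ≤ 2 * _ + 1
  omega

theorem encode_guard_le_sizeBound {w : PolyCode AlgCode} (hw : w ∈ atomPolys x.1.2) :
    @encode (PolyCode AlgCode) Primcodable.toEncodable w ≤ sizeBound x := by
  refine (encode_le_of_mem_atomPolys hw).trans ?_
  exact (Nat.right_le_pair _ _).trans ((Nat.left_le_pair _ _).trans (Nat.le_succ _))

theorem encode_set_le_sizeBound {w : PolyCode AlgCode} (hw : w ∈ atomPolys x.2.2.2) :
    @encode (PolyCode AlgCode) Primcodable.toEncodable w ≤ sizeBound x := by
  refine (encode_le_of_mem_atomPolys hw).trans ?_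
  exact (Nat.right_le_pair _ _).trans ((Nat.right_le_pair _ _).trans
    ((Nat.right_le_pair _ _).trans (Nat.le_succ _)))

theorem encode_coef_le_sizeBound {α : AlgCode} (hα : α ∈ inputCoefs x) :
    @encode AlgCode Primcodable.toEncodable α ≤ sizeBound x := by
  obtain ⟨w, hw, hα⟩ := List.mem_flatMap.1 hα
  obtain ⟨m, hm, rfl⟩ := List.mem_map.1 hα
  have h : @encode AlgCode Primcodable.toEncodable m.1 ≤
      @encode (PolyCode AlgCode) Primcodable.toEncodable w :=
    (Nat.left_le_pair _ _).trans (encode_lt_of_mem hm).le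
  refine h.trans ?_
  rcases List.mem_append.1 hw with hw | hw
  · rcases List.mem_append.1 hw with hw | hw
    · exact encode_update_le_sizeBound x hw
    · exact encode_guard_le_sizeBound x hw
  · exact encode_set_le_sizeBound x hw

variable {x}

theorem coefVar_lt {α : AlgCode} (hα : α ∈ inputCoefs x) : coefVar α < algCount x := by
  rw [algCount]
  exact blockVar_lt (by omega) (by have := encode_coef_le_sizeBound x hα; omega) (by omega)

theorem algVar_lt {i : ℕ} (hi : i < x.2.1) : algVar i < algCount x := by
  rw [algCount]
  exact blockVar_lt (by omega) (by have := algVars_le_sizeBound x; omega) (by omega)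

theorem orbitVar_lt {t i : ℕ} (ht : t ≤ 6 * rootCount x + 1) (hi : i < x.1.1.length) :
    orbitVar t i < algCount x := by
  rw [algCount]
  exact blockVar_lt (by omega) (by omega) (by have := length_le_sizeBound x; omega)

theorem rootVar_lt {j : ℕ} (hj : j ≤ rootCount x) : rootVar j < algCount x := by
  rw [algCount]
  exact blockVar_lt (by omega) (by omega) (by omega)

end Sizes

/-! ### The matrix of the output -/

theorem PolyCode.Represents.exists_coef {κ R : Type} [CommSemiring R] {rep : κ → R → Prop} {n : ℕ}
    {w : PolyCode κ} {p : MvPolynomial (Fin n) R} (h : PolyCode.Represents rep w p) :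
    ∀ α ∈ w.map Prod.fst, ∃ a, rep α a := by
  induction h with
  | nil => simp
  | cons m hα _ ih => exact List.forall_mem_cons.2 ⟨⟨_, hα⟩, ih⟩

theorem LoopCode.Represents.length_eq {d : ℕ} {u : LoopCode} {L : PolyLoop d}
    (h : u.Represents L) : u.1.length = d := by
  simpa using h.1.length_eq

theorem LoopCode.Represents.update {d : ℕ} {u : LoopCode} {L : PolyLoop d}
    (h : u.Represents L) (i : Fin d) :
    PolyCode.Represents AlgCode.Represents (u.1.getD i []) (L.update i) := by
  have hi : (i : ℕ) < u.1.length := h.length_eq ▸ i.2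
  have := h.1.get hi (by simp)
  rw [List.getD_eq_getElem _ _ hi]
  simpa using this

/-- The values `V` of the variables consist of the values of the coefficient codes, values of the
quantified variables of `ψ` that put the first point of the orbit into the set that `ψ` defines, an
initial part of the orbit, and positive increasing characteristic roots of the values of the
polynomials in the loop condition on the even and odd points of the orbit, which show that the loop
condition eventually holds. -/
structure IsWitness {d : ℕ} (x : Input) (L : PolyLoop d) (ψ : ExFormula RealAlg d)
    (V : ℕ → RealAlg) : Prop where
  coef : ∀ α ∈ inputCoefs x, AlgCode.Represents α (V (coefVar α))
  set : ψ.matrix.Holds fun p => MvPolynomial.aeval (Fin.append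
    (Fin.append (fun i : Fin ψ.algVars => V (algVar i))
      (fun i : Fin ψ.ringVars => V (algCount x + i))) (fun i : Fin d => V (orbitVar 0 i))) p
  orbit : ∀ t < 6 * rootCount x + 1, ∀ i : Fin d,
    V (orbitVar (t + 1) i) = MvPolynomial.eval (fun j : Fin d => V (orbitVar t j)) (L.update i)
  root_neg : ∀ j < rootCount x, V (rootVar j) < 0
  root_mono : ∀ j, j + 1 < rootCount x → V (rootVar (j + 1)) ≤ V (rootVar j)
  recurrence : ∀ w ∈ atomPolys x.1.2, ∀ p : MvPolynomial (Fin d) RealAlg,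
    PolyCode.Represents AlgCode.Represents w p → ∀ i < 2 * rootCount x,
      iterDiff (fun j => V (rootVar j)) (rootCount x) (fun l => MvPolynomial.eval
        (fun j : Fin d => V (orbitVar (2 * l + (2 * rootCount x + i)) j)) p) 0 = 0
  guard : ∀ r < 2, L.guard.Interp fun b p => LastSign b (fun j =>
    iterDiff (fun j => V (rootVar j)) j (fun l => MvPolynomial.eval
      (fun j : Fin d => V (orbitVar (2 * l + (2 * rootCount x + r)) j)) p) 0) (rootCount x)

section Means

open FormCode

variable {d : ℕ} {x : Input} {L : PolyLoop d} {ψ : ExFormula RealAlg d}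

theorem means_setCode {u : LoopCode} {w : ExCode AlgCode} (hu : u.Represents L)
    (hw : ExCode.Represents AlgCode.Represents w ψ) :
    Means (algCount (u, w) + w.2.1)
      (fun V => ∀ α ∈ inputCoefs (u, w), AlgCode.Represents α (V (coefVar α)))
      (setCode (setVars u.1.length w.1 w.2.1 (algCount (u, w))) w.2.2)
      (fun V => ψ.matrix.Holds fun p => MvPolynomial.aeval (Fin.append
        (Fin.append (fun i : Fin ψ.algVars => V (algVar i))
          (fun i : Fin ψ.ringVars => V (algCount (u, w) + i)))
            (fun i : Fin d => V (orbitVar 0 i))) p) := by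
  obtain ⟨k', k, g⟩ := w
  obtain ⟨l', l, φ⟩ := ψ
  obtain ⟨h₁, h₂, hg⟩ := hw
  dsimp only at h₁ h₂ hg
  subst h₁ h₂
  dsimp only
  set x : Input := (u, (k', k, g)) with hx
  have hlen := hu.length_eq
  have hatom : ∀ b, ∀ w ∈ atomPolys g, ∀ p, PolyCode.Represents AlgCode.Represents w p →
      Means (algCount x + k)
        (fun V => ∀ α ∈ inputCoefs x, AlgCode.Represents α (V (coefVar α)))
        [Sum.inr (b, translate (setVars u.1.length k' k (algCount x)) w)]
        (fun V => SignHolds b (MvPolynomial.aeval (Fin.append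
          (Fin.append (fun i : Fin k' => V (algVar i)) (fun i : Fin k => V (algCount x + i)))
            (fun i : Fin d => V (orbitVar 0 i))) p)) := by
    intro b w hw p hp
    have hcoef : ∀ α ∈ w.map Prod.fst, α ∈ inputCoefs x := fun α hα =>
      List.mem_flatMap.2 ⟨w, List.mem_append_right _ hw, hα⟩
    refine (means_atom b (varsLT_translate (fun v hv => ?_) fun α hα =>
      (coefVar_lt (hcoef α hα)).trans_le (Nat.le_add_right _ _))).congr fun V hV => ?_
    · rw [setVars, List.mem_append, List.mem_append, List.mem_map, List.mem_map, orbitVars,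
        List.mem_map] at hv
      rcases hv with (⟨i, hi, rfl⟩ | ⟨i, hi, rfl⟩) | ⟨i, hi, rfl⟩ <;> rw [List.mem_range] at hi
      · exact (algVar_lt (x := x) hi).trans_le (Nat.le_add_right _ _)
      · exact Nat.add_lt_add_left hi _
      · exact (orbitVar_lt (x := x) (by omega) hi).trans_le (Nat.le_add_right _ _)
    · rw [val_translate hp (by simp [setVars, hlen, add_assoc]) fun α hα => hV α (hcoef α hα), hlen,
        setVars_getD]
      rfl
  exact (means_subst hg hatom).congr fun V _ => (PropFormula.holds_iff_interp _ _).symm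

variable {A : (ℕ → RealAlg) → Prop} {n : ℕ}

theorem means_orbitCode {u : LoopCode} {w : ExCode AlgCode} (hu : u.Represents L)
    (hn : algCount (u, w) ≤ n) :
    Means n (fun V => ∀ α ∈ inputCoefs (u, w), AlgCode.Represents α (V (coefVar α)))
      (orbitCode u.1 (6 * rootCount (u, w) + 1))
      (fun V => ∀ t < 6 * rootCount (u, w) + 1, ∀ i : Fin d, V (orbitVar (t + 1) i) =
        MvPolynomial.eval (fun j : Fin d => V (orbitVar t j)) (L.update i)) := by
  have hlen := hu.length_eq
  have hmem : ∀ i : Fin d, u.1.getD i [] ∈ u.1 := fun i => by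
    rw [List.getD_eq_getElem _ _ (hlen ▸ i.2)]
    exact List.getElem_mem _
  have hcoef : ∀ i : Fin d, ∀ α ∈ (u.1.getD i []).map Prod.fst, α ∈ inputCoefs (u, w) :=
    fun i α hα => List.mem_flatMap.2
      ⟨_, List.mem_append_left _ (List.mem_append_left _ (hmem i)), hα⟩
  have horb : ∀ t ≤ 6 * rootCount (u, w) + 1, ∀ i < u.1.length, orbitVar t i < n :=
    fun t ht i hi => (orbitVar_lt (x := (u, w)) ht hi).trans_le hn
  refine (means_conj_range (P := fun t V => ∀ i < u.1.length, VarPoly.val V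
    (((-1, 0), [orbitVar (t + 1) i]) :: translate (orbitVars u.1.length t) (u.1.getD i [])) = 0)
      fun t ht => means_conj_range fun i hi => means_eqZero ?_).congr fun V hV => ?_
  · refine List.forall_mem_cons.2 ⟨fun v hv => ?_, varsLT_translate (fun v hv => ?_) fun α hα =>
      (coefVar_lt (hcoef ⟨i, hlen ▸ hi⟩ α hα)).trans_le hn⟩
    · rw [List.mem_singleton.1 hv]
      exact horb _ (by omega) i hi
    · obtain ⟨j, hj, rfl⟩ := List.mem_map.1 hv
      exact horb _ (by omega) j (List.mem_range.1 hj)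
  · refine forall₂_congr fun t _ => ?_
    rw [hlen, ← Fin.forall_iff (p := fun i : Fin d => VarPoly.val V
      (((-1, 0), [orbitVar (t + 1) i]) :: translate (orbitVars d t) (u.1.getD i [])) = 0)]
    refine forall_congr' fun i => ?_
    rw [VarPoly.val_cons, val_translate (hu.update i) (length_orbitVars d t) fun α hα =>
      hV α (hcoef i α hα)]
    simp only [orbitVars_getD, RatCode.toRat_int]
    rw [List.map_singleton, List.prod_singleton]
    push_cast
    rw [neg_one_mul, neg_add_eq_zero]

theorem means_rootCode {N : ℕ} (hn : ∀ j < N, rootVar j < n) :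
    Means n A (rootCode N) (fun V => (∀ j < N, V (rootVar j) < 0) ∧
      ∀ j, j + 1 < N → V (rootVar (j + 1)) ≤ V (rootVar j)) := by
  refine (means_conj_of_forall₂ (.cons (means_conj_range fun j hj => means_atom true ?_) (.cons
    (means_conj_range fun j hj => means_atom false ?_) .nil))).congr fun V _ => ?_
  · intro y hy v hv
    rw [List.mem_singleton.1 hy, List.mem_singleton] at hv
    exact hv ▸ hn j hj
  · intro y hy v hv
    simp only [List.mem_cons, List.not_mem_nil, or_false] at hy
    rcases hy with rfl | rfl <;> rw [List.mem_singleton.1 hv]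
    · exact hn j (by omega)
    · exact hn _ (by omega)
  · simp only [List.forall_mem_cons, List.not_mem_nil, false_imp_iff, implies_true, and_true]
    refine and_congr (forall₂_congr fun j _ => ?_) (forall_congr' fun j => ?_)
    · simp [SignHolds]
    · refine imp_congr (by omega) ?_
      simp [SignHolds]

theorem val_diffPoly_orbit {w : PolyCode AlgCode} {p : MvPolynomial (Fin d) RealAlg}
    (hp : PolyCode.Represents AlgCode.Represents w p) {V : ℕ → RealAlg}
    (hV : ∀ α ∈ w.map Prod.fst, AlgCode.Represents α (V (coefVar α))) (t j : ℕ) :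
    (diffPoly d t w j).val V = iterDiff (fun i => V (rootVar i)) j
      (fun l => MvPolynomial.eval (fun i : Fin d => V (orbitVar (2 * l + t) i)) p) 0 := by
  rw [val_diffPoly]
  simp only [val_translate hp (length_orbitVars d _) hV, orbitVars_getD]

theorem varsLT_diffPoly_of_mem {u : LoopCode} {w : ExCode AlgCode} {q : PolyCode AlgCode}
    (hq : q ∈ atomPolys u.2) (hn : algCount (u, w) ≤ n) {t j : ℕ} (hj : j ≤ rootCount (u, w))
    (ht : t ≤ 4 * rootCount (u, w) + 1) : (diffPoly u.1.length t q j).VarsLT n :=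
  varsLT_diffPoly
    (fun s hs i hi => (orbitVar_lt (x := (u, w)) (by omega) hi).trans_le hn)
    (fun i hi => (rootVar_lt (x := (u, w)) (by omega)).trans_le hn)
    (fun α hα => (coefVar_lt (x := (u, w)) (List.mem_flatMap.2
      ⟨q, List.mem_append_left _ (List.mem_append_right _ hq), hα⟩)).trans_le hn)

theorem means_recurrenceCode {u : LoopCode} {w : ExCode AlgCode} (hu : u.Represents L)
    (hn : algCount (u, w) ≤ n) :
    Means n (fun V => ∀ α ∈ inputCoefs (u, w), AlgCode.Represents α (V (coefVar α)))
      (recurrenceCode u.1.length (rootCount (u, w)) (atomPolys u.2))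
      (fun V => ∀ q ∈ atomPolys u.2, ∀ p : MvPolynomial (Fin d) RealAlg,
        PolyCode.Represents AlgCode.Represents q p → ∀ i < 2 * rootCount (u, w),
          iterDiff (fun j => V (rootVar j)) (rootCount (u, w)) (fun l => MvPolynomial.eval
            (fun j : Fin d => V (orbitVar (2 * l + (2 * rootCount (u, w) + i)) j)) p) 0 = 0) := by
  have hlen := hu.length_eq
  refine (means_conj fun q hq => means_conj_range fun i hi => means_eqZero
    (varsLT_diffPoly_of_mem hq hn le_rfl (by omega))).congr fun V hV => ?_
  refine forall₂_congr fun q hq => ?_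
  have hval := fun (p : MvPolynomial (Fin d) RealAlg)
    (hp : PolyCode.Represents AlgCode.Represents q p) => val_diffPoly_orbit hp fun α hα =>
      hV α (List.mem_flatMap.2
        ⟨q, List.mem_append_left _ (List.mem_append_right _ hq), hα⟩)
  obtain ⟨p, hp⟩ := hu.2.exists_of_mem hq
  rw [hlen]
  constructor
  · intro h p hp i hi
    rw [← hval p hp]
    exact h i hi
  · intro h i hi
    rw [hval p hp]
    exact h p hp i hi

theorem means_guardCode {u : LoopCode} {w : ExCode AlgCode} (hu : u.Represents L)
    (hn : algCount (u, w) ≤ n) {r : ℕ} (hr : r < 2) :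
    Means n (fun V => ∀ α ∈ inputCoefs (u, w), AlgCode.Represents α (V (coefVar α)))
      (guardCode u.1.length (rootCount (u, w)) (2 * rootCount (u, w) + r) u.2)
      (fun V => L.guard.Interp fun b p => LastSign b (fun j =>
        iterDiff (fun j => V (rootVar j)) j (fun l => MvPolynomial.eval
          (fun j : Fin d => V (orbitVar (2 * l + (2 * rootCount (u, w) + r)) j)) p) 0)
            (rootCount (u, w))) := by
  refine means_subst hu.2 fun b q hq p hp => (means_lastSignCode b fun j hj =>
    varsLT_diffPoly_of_mem hq hn hj.le (by omega)).congr fun V hV => ?_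
  rw [hu.length_eq]
  simp only [val_diffPoly_orbit hp fun α hα => hV α (List.mem_flatMap.2
    ⟨q, List.mem_append_left _ (List.mem_append_right _ hq), hα⟩)]

theorem exists_represents_of_mem_inputCoefs {u : LoopCode} {w : ExCode AlgCode}
    (hu : u.Represents L) (hw : ExCode.Represents AlgCode.Represents w ψ) {α : AlgCode}
    (hα : α ∈ inputCoefs (u, w)) : ∃ a, AlgCode.Represents α a := by
  obtain ⟨q, hq, hα⟩ := List.mem_flatMap.1 hα
  rcases List.mem_append.1 hq with hq | hq
  · rcases List.mem_append.1 hq with hq | hq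
    · obtain ⟨i, hi, rfl⟩ := List.getElem_of_mem hq
      have := hu.update ⟨i, hu.length_eq ▸ hi⟩
      rw [List.getD_eq_getElem _ _ hi] at this
      exact this.exists_coef α hα
    · obtain ⟨p, hp⟩ := hu.2.exists_of_mem hq
      exact hp.exists_coef α hα
  · obtain ⟨p, hp⟩ := hw.2.2.exists_of_mem hq
    exact hp.exists_coef α hα

theorem means_matrixCode {u : LoopCode} {w : ExCode AlgCode} (hu : u.Represents L)
    (hw : ExCode.Represents AlgCode.Represents w ψ) :
    Means (algCount (u, w) + w.2.1) (fun _ => True) (matrixCode (u, w))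
      (IsWitness (u, w) L ψ) := by
  have hn : algCount (u, w) ≤ algCount (u, w) + w.2.1 := Nat.le_add_right _ _
  have hcoef : Means (algCount (u, w) + w.2.1) (fun _ => True)
      (conj ((inputCoefs (u, w)).map coefCode))
      (fun V => ∀ α ∈ inputCoefs (u, w), AlgCode.Represents α (V (coefVar α))) :=
    means_conj fun α hα => means_coefCode (exists_represents_of_mem_inputCoefs hu hw hα)
      ((coefVar_lt hα).trans_le hn)
  have hroot := means_rootCode (N := rootCount (u, w))
    (A := fun V => ∀ α ∈ inputCoefs (u, w), AlgCode.Represents α (V (coefVar α)))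
    fun j hj => (rootVar_lt (x := (u, w)) hj.le).trans_le hn
  have h := hcoef.and_of (means_conj_of_forall₂ (.cons (means_setCode hu hw)
    (.cons (means_orbitCode hu hn) (.cons hroot (.cons (means_recurrenceCode hu hn)
      (.cons (means_conj_range fun r hr => means_guardCode hu hn hr) .nil))))))
  rw [matrixCode]
  refine h.congr fun V _ => ?_
  simp only [List.forall_mem_cons, List.not_mem_nil, false_imp_iff, implies_true, and_true]
  constructor
  · rintro ⟨h₁, h₂, h₃, ⟨h₄, h₅⟩, h₆, h₇⟩
    exact ⟨h₁, h₂, h₃, h₄, h₅, h₆, h₇⟩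
  · intro h
    exact ⟨h.coef, h.set, h.orbit, ⟨h.root_neg, h.root_mono⟩, h.recurrence, h.guard⟩

end Means

/-! ### Correctness of the reduction -/

/-- A code represents at most one polynomial if this holds for the codes of coefficients. -/
theorem PolyCode.Represents.unique {κ R : Type} [CommSemiring R] {rep : κ → R → Prop}
    (hrep : ∀ u α β, rep u α → rep u β → α = β) {n : ℕ} {w : PolyCode κ}
    {p q : MvPolynomial (Fin n) R} (hp : PolyCode.Represents rep w p)
    (hq : PolyCode.Represents rep w q) : p = q := by
  induction hp generalizing q with
  | nil => cases hq; rfl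
  | @cons u α w p m hu _ ih =>
    generalize hw : (u, List.ofFn m) :: w = w' at hq
    cases hq with
    | nil => simp at hw
    | @cons u' α' w' p' m' hu' hp' =>
      simp only [List.cons.injEq, Prod.mk.injEq] at hw
      obtain ⟨⟨rfl, hm⟩, rfl⟩ := hw
      rw [DFunLike.coe_injective (List.ofFn_injective hm), hrep _ _ _ hu hu', ih hp']

theorem lastSign_congr {K : Type*} [Field K] [LinearOrder K] (b : Bool) {U U' : ℕ → K} {N : ℕ}
    (h : ∀ j < N, U j = U' j) : LastSign b U N ↔ LastSign b U' N := by
  induction N with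
  | zero => rfl
  | succ N ih => simp only [LastSign, h N (by omega), ih fun j hj => h j (by omega)]

theorem exists_common_roots {K : Type*} [Field K] {k : ℕ} (l : List (ℕ → K))
    (h : ∀ u ∈ l, SplitRecurrence k u) :
    ∃ bs : List K, bs.length ≤ l.length * k ∧ ∀ u ∈ l, Annihilates (rootPoly bs) u := by
  induction l with
  | nil => exact ⟨[], by simp, by simp⟩
  | cons u l ih =>
    rw [List.forall_mem_cons] at h
    obtain ⟨bs, hbs, hu⟩ := h.1
    obtain ⟨cs, hcs, hl⟩ := ih h.2
    refine ⟨bs ++ cs, ?_, List.forall_mem_cons.2 ⟨?_, fun v hv => ?_⟩⟩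
    · rw [List.length_append, List.length_cons, add_one_mul, add_comm]
      exact Nat.add_le_add hcs hbs
    · rw [rootPoly_append]
      exact hu.of_dvd (dvd_mul_right _ _)
    · rw [rootPoly_append]
      exact (hl v hv).of_dvd (dvd_mul_left _ _)

section Equivalence

variable {d : ℕ} {L : PolyLoop d} {u : LoopCode} {w : ExCode AlgCode}

/-- The number of characteristic roots in the output suffices for all polynomials in the loop
condition together. -/
theorem exists_roots_orbit (hL : L.IsTwn) (hu : u.Represents L) (c : Fin d → RealAlg) :
    ∃ bs : List RealAlg, bs.length ≤ rootCount (u, w) ∧ ∀ q ∈ atomPolys u.2,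
      ∀ p : MvPolynomial (Fin d) RealAlg, PolyCode.Represents AlgCode.Represents q p →
        Annihilates (rootPoly bs) (fun n => MvPolynomial.eval (L.step^[n] c) p) := by
  classical
  set B := sizeBound (u, w) with hBdef
  have hB : 1 ≤ B := Nat.le_add_left _ _
  have hdB : d ≤ B := hu.length_eq ▸ length_le_sizeBound (u, w)
  have hsize : ∀ i, SizeLE B (L.update i) := fun i => by
    refine (hu.update i).sizeLE (encode_update_le_sizeBound (u, w) ?_)
    rw [List.getD_eq_getElem _ _ (hu.length_eq ▸ i.2)]
    exact List.getElem_mem _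
  let f : PolyCode AlgCode → ℕ → RealAlg := fun q n =>
    if h : ∃ p : MvPolynomial (Fin d) RealAlg, PolyCode.Represents AlgCode.Represents q p then
      MvPolynomial.eval (L.step^[n] c) h.choose else 0
  have hf : ∀ q (p : MvPolynomial (Fin d) RealAlg),
      PolyCode.Represents AlgCode.Represents q p →
        f q = fun n => MvPolynomial.eval (L.step^[n] c) p := by
    intro q p hp
    have h : ∃ p : MvPolynomial (Fin d) RealAlg,
      PolyCode.Represents AlgCode.Represents q p := ⟨p, hp⟩
    funext n
    simp only [f, dif_pos h]
    rw [PolyCode.Represents.unique (rep := AlgCode.Represents)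
      (fun _ _ _ => AlgCode.Represents.unique) h.choose_spec hp]
  obtain ⟨bs, hbs, h⟩ := exists_common_roots ((atomPolys u.2).map f)
    (k := B * orderBound B (B + 1) ^ B) fun v hv => by
      obtain ⟨q, hq, rfl⟩ := List.mem_map.1 hv
      obtain ⟨p, hp⟩ := hu.2.exists_of_mem hq
      rw [hf q p hp]
      exact PolyLoop.splitRecurrence_eval_orbit hL hB hdB hsize c
        (hp.sizeLE (encode_guard_le_sizeBound (u, w) hq))
  refine ⟨bs, hbs.trans ?_, fun q hq p hp => ?_⟩
  · have hle : (atomPolys u.2).length ≤ u.2.length := by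
      rw [atomPolys, List.length_flatMap]
      refine (List.sum_le_card_nsmul _ 1 fun x hx => ?_).trans (by simp)
      obtain ⟨y | y, _, rfl⟩ := List.mem_map.1 hx <;> simp
    rw [List.length_map, rootCount]
    refine Nat.mul_le_mul_right _ ?_
    exact hle.trans (length_guard_le_sizeBound (u, w))
  · rw [← hf q p hp]
    exact h _ (List.mem_map_of_mem hq)

theorem Annihilates.everyOther {bs : List RealAlg} {v : ℕ → RealAlg}
    (h : Annihilates (rootPoly bs) v) (t : ℕ) :
    Annihilates (rootPoly (bs.map (· ^ 2))) (fun l => v (2 * l + t)) :=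
  (h.shift t).subsequence

theorem IsWitness.orbit_eq {ψ : ExFormula RealAlg d} {x : Input} {V : ℕ → RealAlg}
    (hV : IsWitness x L ψ V) {t : ℕ} (ht : t ≤ 6 * rootCount x + 1) :
    (fun j : Fin d => V (orbitVar t j)) = L.step^[t] (fun j : Fin d => V (orbitVar 0 j)) := by
  induction t with
  | zero => rfl
  | succ t ih =>
    funext i
    rw [hV.orbit t (by omega) i, ih (by omega), PolyLoop.step_iterate_succ_apply]

/-- For `r < 2` the loop condition eventually holds on the points `2 * l + r` of the orbit: the
guessed roots are correct, because the sequence `∏ (E - s) v` satisfies a recurrence of order at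
most `rootCount x` and vanishes initially. -/
theorem IsWitness.eventually_guardHolds {ψ : ExFormula RealAlg d} {V : ℕ → RealAlg}
    (hL : L.IsTwn) (hu : u.Represents L) (hV : IsWitness (u, w) L ψ V) {r : ℕ} (hr : r < 2) :
    ∀ᶠ l in atTop, L.GuardHolds
      (L.step^[2 * l + (2 * rootCount (u, w) + r)] fun j : Fin d => V (orbitVar 0 j)) := by
  set N := rootCount (u, w) with hN
  set c : Fin d → RealAlg := fun j => V (orbitVar 0 j) with hc
  set m : ℕ → RealAlg := fun j => V (rootVar j) with hm
  obtain ⟨bs, hbs, hann⟩ := exists_roots_orbit (w := w) hL hu c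
  have hev := hu.2.eventually_interp
    (s := fun l b p => SignHolds b (MvPolynomial.eval (L.step^[2 * l + (2 * N + r)] c) p))
    (t := fun b p => LastSign b (fun j => iterDiff m j (fun l => MvPolynomial.eval
      (fun j : Fin d => V (orbitVar (2 * l + (2 * N + r)) j)) p) 0) N) fun q hq p hp b => by
    set v : ℕ → RealAlg := fun l => MvPolynomial.eval (L.step^[2 * l + (2 * N + r)] c) p with hv
    have hann' := ((hann q hq p hp).everyOther (2 * N + r)).aeval
      (∏ i ∈ Finset.range N, (Polynomial.X + Polynomial.C (m i)))
    rw [aeval_shift_prod] at hann'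
    have hzero : iterDiff m N v = 0 := by
      refine eq_zero_of_initial (N := N) (by simpa using hbs) hann' fun k hk => ?_
      have hrec := hV.recurrence q hq p hp (2 * k + r) (by omega)
      rw [← zero_add k, ← iterDiff_shift, ← hrec]
      refine iterDiff_congr _ _ (fun _ _ => rfl) fun i hi => ?_
      rw [zero_add, hV.orbit_eq (by omega)]
      simp only [hv]
      congr 3
      omega
    refine (eventually_signHolds_iff hV.root_neg hV.root_mono
      (fun n => congrFun hzero n) b).mono fun l hl => hl.trans ?_
    refine lastSign_congr b fun j hj => iterDiff_congr _ _ (fun _ _ => rfl) fun i hi => ?_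
    simp only [hv]
    rw [hV.orbit_eq (by omega)]
  filter_upwards [hev] with l hl
  exact (PropFormula.holds_iff_interp _ _).2 (hl.2 (hV.guard r hr))

theorem IsWitness.not_terminatesOn {ψ : ExFormula RealAlg d} {V : ℕ → RealAlg}
    {F : Set (Fin d → RealAlg)} (hL : L.IsTwn) (hF : L.Invariant F) (hu : u.Represents L)
    (hV : IsWitness (u, w) L ψ V) (hVF : (fun j : Fin d => V (orbitVar 0 j)) ∈ F) :
    ¬ L.TerminatesOn F := by
  obtain ⟨l₀, h₀⟩ := eventually_atTop.1 (hV.eventually_guardHolds hL hu (r := 0) (by omega))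
  obtain ⟨l₁, h₁⟩ := eventually_atTop.1 (hV.eventually_guardHolds hL hu (r := 1) (by omega))
  set N := rootCount (u, w) with hN
  set n₀ := 2 * max l₀ l₁ + 2 * N with hn₀
  refine not_not.2 ⟨L.step^[n₀] fun j : Fin d => V (orbitVar 0 j), ?_, fun n => ?_⟩
  · generalize n₀ = k
    induction k with
    | zero => exact hVF
    | succ k ih => rw [Function.iterate_succ_apply']; exact hF _ ih
  · rw [← Function.iterate_add_apply]
    rcases Nat.even_or_odd' n with ⟨k, rfl | rfl⟩
    · have := h₀ (k + max l₀ l₁) (le_trans (le_max_left _ _) (Nat.le_add_left _ _))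
      rwa [show 2 * (k + max l₀ l₁) + (2 * N + 0) = 2 * k + n₀ by omega] at this
    · have := h₁ (k + max l₀ l₁) (le_trans (le_max_right _ _) (Nat.le_add_left _ _))
      rwa [show 2 * (k + max l₀ l₁) + (2 * N + 1) = 2 * k + 1 + n₀ by omega] at this

/-- The blocks of variables do not overlap, so that they can be given arbitrary values. -/
theorem exists_assignment {R : Type*} (K : ℕ) (z y' m y : ℕ → R) (x : ℕ → ℕ → R) :
    ∃ V : ℕ → R, (∀ a, blockVar 0 a 0 < K → V (blockVar 0 a 0) = z a) ∧
      (∀ i, algVar i < K → V (algVar i) = y' i) ∧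
      (∀ t i, orbitVar t i < K → V (orbitVar t i) = x t i) ∧
      (∀ j, rootVar j < K → V (rootVar j) = m j) ∧ ∀ i, V (K + i) = y i := by
  refine ⟨fun v => if v < K then
    (match v.unpair.1 with
      | 0 => z v.unpair.2.unpair.1
      | 1 => y' v.unpair.2.unpair.1
      | 2 => x v.unpair.2.unpair.1 v.unpair.2.unpair.2
      | _ => m v.unpair.2.unpair.1) else y (v - K), ?_, ?_, ?_, ?_, ?_⟩
  · intro a h; simp only [if_pos h]; simp [blockVar]
  · intro a h; simp only [if_pos h]; simp [algVar, blockVar]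
  · intro t a h; simp only [if_pos h]; simp [orbitVar, blockVar]
  · intro a h; simp only [if_pos h]; simp [rootVar, blockVar]
  · intro i; simp

/-- The values of the variables are read off a point with an infinite run. -/
theorem exists_isWitness {ψ : ExFormula RealAlg d} {S : Subring RealAlg} (hL : L.IsTwn)
    (hu : u.Represents L) (hw : ExCode.Represents AlgCode.Represents w ψ) {c : Fin d → RealAlg}
    (hc : ψ.Holds S c) (hrun : ∀ n, L.GuardHolds (L.step^[n] c)) :
    ∃ V : ℕ → RealAlg, (∀ i < w.2.1, V (algCount (u, w) + i) ∈ S) ∧ IsWitness (u, w) L ψ V := by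
  classical
  obtain ⟨y', y, hyS, hψ⟩ := hc
  obtain ⟨bs, hbs, hann⟩ := exists_roots_orbit (w := w) hL hu c
  obtain ⟨m, hneg, hmono, hm⟩ := exists_sorted_roots (bs := bs.map (· ^ 2)) (fun b hb => by
    obtain ⟨a, _, rfl⟩ := List.mem_map.1 hb
    exact sq_nonneg a) (N := rootCount (u, w)) (by simpa using hbs)
  obtain ⟨V, hz, hV', hVx, hVm, hVy⟩ := exists_assignment (algCount (u, w))
    (fun a => match @decode AlgCode Primcodable.toEncodable a with
      | some α => if h : ∃ x, AlgCode.Represents α x then h.choose else 0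
      | none => 0)
    (fun i => if h : i < ψ.algVars then y' ⟨i, h⟩ else 0) m
    (fun i => if h : i < ψ.ringVars then y ⟨i, h⟩ else 0)
    (fun t i => if h : i < d then L.step^[t] c ⟨i, h⟩ else 0)
  set N := rootCount (u, w) with hN
  have horb : ∀ t ≤ 6 * N + 1, (fun j : Fin d => V (orbitVar t j)) = L.step^[t] c := by
    intro t ht
    funext j
    rw [hVx t j (orbitVar_lt (x := (u, w)) ht (hu.length_eq ▸ j.2)), dif_pos j.2]
  have hroot : ∀ j < N, V (rootVar j) = m j := fun j hj => hVm j (rootVar_lt (x := (u, w)) hj.le)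
  have hdiff : ∀ v v' : ℕ → RealAlg, ∀ j ≤ N, (∀ i ≤ j, v i = v' i) →
      iterDiff (fun j => V (rootVar j)) j v 0 = iterDiff m j v' 0 := by
    intro v v' j hj h
    exact iterDiff_congr j 0 (fun i hi => hroot i (by omega)) fun i hi => by rw [zero_add, h i hi]
  have hkill : ∀ q ∈ atomPolys u.2, ∀ p : MvPolynomial (Fin d) RealAlg,
      PolyCode.Represents AlgCode.Represents q p → ∀ i n, iterDiff m N
        (fun l => MvPolynomial.eval (L.step^[2 * l + (2 * N + i)] c) p) n = 0 := by
    intro q hq p hp i n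
    have := hm _ ((hann q hq p hp).everyOther i) N le_rfl n
    simpa only [mul_add, add_assoc] using this
  refine ⟨V, fun i hi => ?_, ⟨fun α hα => ?_, ?_, fun t ht i => ?_, fun j hj => ?_,
    fun j hj => ?_, fun q hq p hp i hi => ?_, fun r hr => ?_⟩⟩
  · have hi' : i < ψ.ringVars := by rw [← hw.2.1]; exact hi
    rw [hVy, dif_pos hi']
    exact hyS _
  · rw [coefVar, hz _ (coefVar_lt (x := (u, w)) hα), encodek]
    have h := exists_represents_of_mem_inputCoefs hu hw hα
    simp only [dif_pos h]
    exact h.choose_spec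
  · have h₁ : (fun i : Fin ψ.algVars => V (algVar i)) = y' := by
      funext i
      rw [hV' i (algVar_lt (x := (u, w)) (i.2.trans_eq hw.1.symm)), dif_pos i.2]
    have h₂ : (fun i : Fin ψ.ringVars => V (algCount (u, w) + i)) = y := by
      funext i
      rw [hVy, dif_pos i.2]
    rw [h₁, h₂, horb 0 (by omega)]
    exact hψ
  · rw [horb t ht.le, ← PolyLoop.step_iterate_succ_apply, ← horb (t + 1) (by omega)]
  · rw [hroot j hj]
    exact hneg j hj
  · rw [hroot j (by omega), hroot (j + 1) hj]
    exact hmono j hj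
  · rw [hdiff _ (fun l => MvPolynomial.eval (L.step^[2 * l + (2 * N + i)] c) p) N le_rfl
      fun l hl => by rw [horb _ (by omega)]]
    exact hkill q hq p hp i 0
  · have hev := hu.2.eventually_interp
      (s := fun l b p => SignHolds b (MvPolynomial.eval (L.step^[2 * l + (2 * N + r)] c) p))
      (t := fun b p => LastSign b (fun j => iterDiff (fun j => V (rootVar j)) j
        (fun l => MvPolynomial.eval
          (fun j : Fin d => V (orbitVar (2 * l + (2 * N + r)) j)) p) 0) N) fun q hq p hp b => by
      refine (eventually_signHolds_iff hneg hmono (hkill q hq p hp r) b).mono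
        fun l hl => hl.trans ?_
      refine lastSign_congr b fun j hj => (hdiff _ _ j hj.le fun i hi => ?_).symm
      rw [horb _ (by omega)]
    obtain ⟨l, hl⟩ := hev.exists
    exact hl.1 ((PropFormula.holds_iff_interp _ _).1 (hrun _))

end Equivalence

/-- Validity of the closed formula with the given matrix, in terms of indexed variables: those with
index `K, …, K + k - 1` range over the subring. -/
theorem FormCode.Means.exists_closed {K k : ℕ} {c : FormCode} {P : (ℕ → RealAlg) → Prop}
    (h : FormCode.Means (K + k) (fun _ => True) c P) (S : Subring RealAlg) :
    ∃ χ : ExFormula ℚ 0, ExCode.Represents RatCode.Represents (K, k, FormCode.toCode (K + k) c) χ ∧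
      (χ.Valid S ↔ ∃ V : ℕ → RealAlg, (∀ i < k, V (K + i) ∈ S) ∧ P V) := by
  obtain ⟨χ, hχ, hP⟩ := h
  refine ⟨⟨K, k, χ⟩, ⟨rfl, rfl, hχ⟩, ?_⟩
  have happ : ∀ (y' : Fin K → RealAlg) (y : Fin k → RealAlg) (V : ℕ → RealAlg),
      (∀ i : Fin K, V i = y' i) → (∀ i : Fin k, V (K + i) = y i) →
        Fin.append (Fin.append y' y) Fin.elim0 = fun i : Fin (K + k) => V i := by
    intro y' y V h₁ h₂
    rw [Fin.append_elim0]
    funext i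
    change Fin.append y' y i = V i
    refine Fin.addCases (motive := fun i => Fin.append y' y i = V i) (fun i => ?_) (fun i => ?_) i
    · simp [h₁]
    · simp [h₂]
  constructor
  · rintro ⟨y', y, hy, hH⟩
    dsimp only at y' y hy hH
    let V : ℕ → RealAlg := fun i => if h : i < K then y' ⟨i, h⟩ else
      if h : i - K < k then y ⟨i - K, h⟩ else 0
    have h₁ : ∀ i : Fin K, V i = y' i := fun i => by simp [V]
    have h₂ : ∀ i : Fin k, V (K + i) = y i := fun i => by simp [V]
    refine ⟨V, fun i hi => by rw [h₂ ⟨i, hi⟩]; exact hy _, (hP V trivial).1 ?_⟩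
    rw [← happ y' y V h₁ h₂]
    exact hH
  · rintro ⟨V, hS, hV⟩
    refine ⟨fun i => V i, fun i => V (K + i), fun i => hS i i.2, ?_⟩
    have := (hP V trivial).2 hV
    rw [← happ _ _ V (fun _ => rfl) fun _ => rfl] at this
    exact this

theorem terminationReducible_isTwn (S : Subring RealAlg) :
    TerminationReducible S (fun _ L => L.IsTwn) := by
  refine ⟨nonterminationCode, primrec_nonterminationCode.to_comp, ?_⟩
  intro d L ψ F hL hF hψ u w hu hw
  obtain ⟨χ, hχ, hvalid⟩ := (means_matrixCode hu hw).exists_closed S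
  refine ⟨χ, hχ, hvalid.trans ⟨?_, fun h => ?_⟩⟩
  · rintro ⟨V, hS, hV⟩
    refine hV.not_terminatesOn hL hF hu ((hψ _).2 ⟨_, _, fun i => hS i ?_, hV.set⟩)
    rw [hw.2.1]
    exact i.2
  · obtain ⟨c, hc, hrun⟩ := not_not.1 h
    exact exists_isWitness hL hu hw ((hψ c).1 hc) hrun

end LoopTermination

theorem mainTheorem1 (S : Subring LoopTermination.RealAlg) :
    LoopTermination.TerminationReducible S (fun _ L => L.IsTnn) ∧
      LoopTermination.TerminationReducible S (fun _ L => L.IsTwn) := by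
  refine ⟨?_, LoopTermination.terminationReducible_isTwn S⟩
  obtain ⟨f, hf, h⟩ := LoopTermination.terminationReducible_isTwn S
  exact ⟨f, hf, fun d L ψ F hL => h d L ψ F ⟨hL.1, hL.2.1⟩⟩
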